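/- Let $G$ be a germ of biholomorphism of $\mathbb{C}^n$ fixing the origin $O$, i.e. a biholomorphism between open subsets of $\mathbb{C}^n$, defined at $O$ with $G(O)=O$, and let $\lambda_1,\dots,\lambda_n$ be the eigenvalues (with multiplicity) of its differential $dG_O$, which is assumed diagonalizable. Suppose that $|\lambda_j|=1$ and $\lambda_j^q\neq 1$ for all $j$ and all integers $q\ge 1$, and that $G$ is one-resonant with respect to all its eigenvalues with generator $\alpha\in\mathbb{N}^n\setminus\{0\}$: for every $j$, the multi-indices $L\in\mathbb{N}^n$ with $|L|\ge 2$ and $\lambda^L=\lambda_j$ are precisely $L=e_j+k\alpha$, $k\ge 1$. Suppose that $G$ is holomorphically normalizable: a biholomorphic change of coordinates fixing $O$ conjugates $G$, near $O$, to a convergent Poincaré–Dulac normal form $$z\mapsto \Big(\lambda_j z_j+\sum_{k\ge 1}a_{j,k}\,z^{k\alpha}z_j\Big)_{j=1,\dots,n}.$$ Suppose that some $a_{j,k}$ is non-zero, let $k_0\ge1$ be the least $k$ such that $a_{j,k}\ne0$ for some $j$, put $a_j=a_{j,k_0}$ and $\Lambda(G)=\sum_{j=1}^n\alpha_j\,a_j/\lambda_j$,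 and suppose that $G$ is non-degenerate, i.e. $\Lambda(G)\neq 0$. Suppose finally that, for some $1\le s<n$, $$\operatorname{Re}\Big(\frac{a_j}{\lambda_j}\frac1{\Lambda(G)}\Big)>0\ \ (1\le j\le s),\qquad \operatorname{Re}\Big(\frac{a_h}{\lambda_h}\frac1{\Lambda(G)}\Big)<0\ \ (s<h\le n).$$ 1. If $\alpha\notin\mathbb{N}^s\times\{0\}^{n-s}$, then $O$ is the only point $w$ of the domain of $G$ whose forward orbit under $G$ is defined (stays in the domain of $G$) and converges to $O$. 2. If $\alpha\in\mathbb{N}^s\times\{0\}^{n-s}$, let $d=\gcd(\alpha_1,\dots,\alpha_n)$. Then $G$ has an $s$-dimensional parabolic manifold at $O$ with $d$ connected components, each of them simply connected: there is a set $P$ in the domain of $G$, the biholomorphic image of an open subset of $\mathbb{C}^s$ that is the disjoint union of $d$ simply connected open sets, such that $O\in\overline P\setminus P$, $G(P)\subseteq P$, and $\lim_{\ell\to\infty}G^{\circ\ell}(z)=O$ for all $z\in P$. In particular, if $d=1$, then $P$ is the biholomorphic image of a simply connected open subset of $\mathbb{C}^s$. -/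

import Mathlib

open Set Filter Topology

/-- `G`, a homeomorphism between open subsets of `ℂⁿ`, represents an element of `Diff(ℂⁿ, O)`:
it is a biholomorphism between open sets, defined at the origin and fixing it. -/
structure IsBiholomorphicGerm {n : ℕ}
    (G : OpenPartialHomeomorph (Fin n → ℂ) (Fin n → ℂ)) : Prop where
  zero_mem_source : (0 : Fin n → ℂ) ∈ G.source
  map_zero : G 0 = 0
  differentiableOn : DifferentiableOn ℂ G G.source
  differentiableOn_symm : DifferentiableOn ℂ G.symm G.target

/-- The monomial `z^L = z₁^{L₁} ⋯ zₙ^{Lₙ}`. -/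
def monomialPow {n : ℕ} (z : Fin n → ℂ) (L : Fin n → ℕ) : ℂ :=
  ∏ i, z i ^ L i

/-- `Res_j(lam)`: the multi-indices `L` with `|L| ≥ 2` and `lam^L = lam_j`. -/
def resonances {n : ℕ} (lam : Fin n → ℂ) (j : Fin n) : Set (Fin n → ℕ) :=
  {L | 2 ≤ ∑ i, L i ∧ monomialPow lam L = lam j}

/-- The differential of `G` at the origin is diagonalizable, with eigenvalues
`lam₁, …, lamₙ` listed with multiplicity. -/
def HasDiagonalizableDifferential {n : ℕ}
    (G : OpenPartialHomeomorph (Fin n → ℂ) (Fin n → ℂ)) (lam : Fin n → ℂ) : Prop :=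
  ∃ b : Module.Basis (Fin n) ℂ (Fin n → ℂ), ∀ j, fderiv ℂ G 0 (b j) = lam j • b j

/-- `G` is one-resonant with respect to all its eigenvalues `lam₁, …, lamₙ`, with generator
`α ≠ 0`: the resonances are precisely the pairs `(j, e_j + k α)` with `k ≥ 1`. -/
structure IsOneResonant {n : ℕ} (G : OpenPartialHomeomorph (Fin n → ℂ) (Fin n → ℂ))
    (lam : Fin n → ℂ) (α : Fin n → ℕ) : Prop where
  differential : HasDiagonalizableDifferential G lam
  generator_ne_zero : α ≠ 0
  resonances_eq : ∀ j, resonances lam j = {L | ∃ k : ℕ, 1 ≤ k ∧ L = Pi.single j 1 + k • α}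

/-- `G` is conjugated, by a biholomorphic change of coordinates `Φ` fixing the origin, to the
convergent Poincaré–Dulac normal form whose `j`-th component is
`lam_j z_j + ∑_{k ≥ 1} a_{j,k} z^{kα} z_j` near the origin. (The value `a j 0` is not used.) -/
def HasHolomorphicNormalForm {n : ℕ} (G : OpenPartialHomeomorph (Fin n → ℂ) (Fin n → ℂ))
    (lam : Fin n → ℂ) (α : Fin n → ℕ) (a : Fin n → ℕ → ℂ) : Prop :=
  ∃ Φ : OpenPartialHomeomorph (Fin n → ℂ) (Fin n → ℂ), IsBiholomorphicGerm Φ ∧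
    ∀ᶠ z in 𝓝 (0 : Fin n → ℂ), ∀ j,
      HasSum (fun k : ℕ => a j (k + 1) * monomialPow z α ^ (k + 1) * z j)
        (Φ (G (Φ.symm z)) j - lam j * z j)

/-- `k₀` is the weighted order: the least `k ≥ 1` for which some coefficient `a_{j,k}` of the
normal form is non-zero. -/
def IsWeightedOrder {n : ℕ} (a : Fin n → ℕ → ℂ) (k₀ : ℕ) : Prop :=
  IsLeast {k : ℕ | 1 ≤ k ∧ ∃ j, a j k ≠ 0} k₀

/-- `Λ = ∑_j α_j a_j / lam_j`, where `a_j = a_{j,k₀}`. -/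
noncomputable def resonantLambda {n : ℕ} (lam : Fin n → ℂ) (α : Fin n → ℕ) (a : Fin n → ℕ → ℂ)
    (k₀ : ℕ) : ℂ :=
  ∑ j, (α j : ℂ) * (a j k₀ / lam j)

/-- The forward orbit of `w` under `G` is well defined (it never leaves the domain of `G`) and
converges to the origin. -/
def OrbitConvergesToOrigin {n : ℕ} (G : OpenPartialHomeomorph (Fin n → ℂ) (Fin n → ℂ))
    (w : Fin n → ℂ) : Prop :=
  (∀ l : ℕ, G^[l] w ∈ G.source) ∧ Tendsto (fun l : ℕ => G^[l] w) atTop (𝓝 0)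

/-- `P ⊆ ℂⁿ` is the biholomorphic image of the open set `D ⊆ ℂˢ`: the image of an injective
holomorphic immersion of `D` which is a homeomorphism onto its image. -/
def IsBiholomorphicImage {s n : ℕ} (D : Set (Fin s → ℂ)) (P : Set (Fin n → ℂ)) : Prop :=
  ∃ φ : (Fin s → ℂ) → (Fin n → ℂ), DifferentiableOn ℂ φ D ∧
    (∀ x ∈ D, Function.Injective (fderiv ℂ φ x)) ∧ IsEmbedding (D.domRestrict φ) ∧ φ '' D = P

/-- `P` is a parabolic manifold of dimension `s` for `G` at the origin, with `d` connected
components: `P` is the biholomorphic image of an open set in `ℂˢ` which is the disjoint union of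
`d` simply connected open sets; the origin is a boundary point of `P`; `G(P) ⊆ P`; and all orbits
in `P` converge to the origin. For `d = 1`, the open set is simply connected. -/
structure IsParabolicManifold {n : ℕ} (G : OpenPartialHomeomorph (Fin n → ℂ) (Fin n → ℂ))
    (s d : ℕ) (P : Set (Fin n → ℂ)) : Prop where
  image : ∃ D : Fin d → Set (Fin s → ℂ), (∀ i, IsOpen (D i)) ∧
    (∀ i, IsSimplyConnected (D i)) ∧ Pairwise (fun i j => Disjoint (D i) (D j)) ∧
    IsBiholomorphicImage (⋃ i, D i) P
  zero_mem_closure : (0 : Fin n → ℂ) ∈ closure P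
  zero_notMem : (0 : Fin n → ℂ) ∉ P
  subset_source : P ⊆ G.source
  mapsTo : MapsTo G P P
  orbits : ∀ z ∈ P, Tendsto (fun l : ℕ => G^[l] z) atTop (𝓝 0)

/-- The right half plane `{R < Re y}`. -/
def halfPlane (R : ℝ) : Set ℂ := {y | R < y.re}

/-- The horizontal half strip `{R < Re ψ, |Im ψ| < 1}`. -/
def halfStrip (R : ℝ) : Set ℂ := {ψ | R < ψ.re ∧ |ψ.im| < 1}

theorem isOpen_halfPlane (R : ℝ) : IsOpen (halfPlane R) :=
  isOpen_lt continuous_const Complex.continuous_re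

theorem isOpen_halfStrip (R : ℝ) : IsOpen (halfStrip R) :=
  (isOpen_lt continuous_const Complex.continuous_re).inter
    (isOpen_lt (continuous_abs.comp Complex.continuous_im) continuous_const)

theorem halfPlane_subset {R R' : ℝ} (h : R ≤ R') : halfPlane R' ⊆ halfPlane R :=
  fun _ hy => lt_of_le_of_lt h hy

/-- `f` maps the half plane `{R < Re y}` holomorphically to itself and moves points to the right
by at least `1/2`. -/
structure MovesRight (f : ℂ → ℂ) (R : ℝ) : Prop where
  differentiableOn : DifferentiableOn ℂ f (halfPlane R)
  add_half_le : ∀ y ∈ halfPlane R, y.re + 1 / 2 ≤ (f y).re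

namespace MovesRight

variable {f : ℂ → ℂ} {R : ℝ}

theorem mono (hf : MovesRight f R) {R' : ℝ} (h : R ≤ R') : MovesRight f R' :=
  ⟨hf.differentiableOn.mono (halfPlane_subset h), fun y hy => hf.add_half_le y (halfPlane_subset h hy)⟩

theorem mapsTo (hf : MovesRight f R) : MapsTo f (halfPlane R) (halfPlane R) := by
  intro y hy
  have := hf.add_half_le y hy
  simp only [halfPlane, mem_ofPred_eq] at *
  linarith

theorem iterate_mem (hf : MovesRight f R) {y : ℂ} (hy : y ∈ halfPlane R) (l : ℕ) :
    f^[l] y ∈ halfPlane R := hf.mapsTo.iterate l hy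

theorem le_re_iterate (hf : MovesRight f R) {y : ℂ} (hy : y ∈ halfPlane R) (l : ℕ) :
    y.re + l / 2 ≤ (f^[l] y).re := by
  induction l with
  | zero => simp
  | succ l ih =>
    rw [Function.iterate_succ_apply']
    have := hf.add_half_le _ (hf.iterate_mem hy l)
    push_cast
    linarith

theorem differentiableOn_iterate (hf : MovesRight f R) (l : ℕ) :
    DifferentiableOn ℂ (f^[l]) (halfPlane R) := by
  induction l with
  | zero => exact differentiableOn_id
  | succ l ih =>
    rw [Function.iterate_succ']
    exact hf.differentiableOn.comp ih (hf.mapsTo.iterate l)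

end MovesRight

theorem summable_rate {δ : ℝ} (hδ : 0 < δ) :
    Summable (fun l : ℕ => (1 + (l : ℝ) / 2) ^ (-(1 + δ))) := by
  have h1 : Summable (fun l : ℕ => ((l : ℝ) + 1) ^ (-(1 + δ))) := by
    have := (summable_nat_add_iff 1).2 (Real.summable_nat_rpow.2 (show -(1 + δ) < -1 by linarith))
    simpa using this
  refine (h1.mul_left ((1 / 2 : ℝ) ^ (-(1 + δ)))).of_nonneg_of_le (fun l => by positivity) ?_
  intro l
  rw [← Real.mul_rpow (by norm_num) (by positivity)]
  exact Real.rpow_le_rpow_of_nonpos (by positivity) (by linarith) (by linarith)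

theorem rate_le {δ R : ℝ} (hδ : 0 < δ) (hR : 1 ≤ R) (l : ℕ) :
    (R + (l : ℝ) / 2) ^ (-(1 + δ)) ≤ R ^ (-(δ / 2)) * (1 + (l : ℝ) / 2) ^ (-(1 + δ / 2)) := by
  have h0 : (0 : ℝ) ≤ l := by positivity
  have h1 : (R + (l : ℝ) / 2) ^ (-(1 + δ))
      = (R + (l : ℝ) / 2) ^ (-(δ / 2)) * (R + (l : ℝ) / 2) ^ (-(1 + δ / 2)) := by
    rw [← Real.rpow_add (by positivity)]
    ring_nf
  rw [h1]
  gcongr ?_ * ?_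
  · exact Real.rpow_le_rpow_of_nonpos (by positivity) (by linarith) (by linarith)
  · exact Real.rpow_le_rpow_of_nonpos (by positivity) (by linarith) (by linarith)

/-- The solution `m` of the cohomological equation `m ∘ f - m = h`. -/
noncomputable def cohomSol (f h : ℂ → ℂ) (y : ℂ) : ℂ := -∑' l : ℕ, h (f^[l] y)

section Cohom

variable {f h : ℂ → ℂ} {R C δ : ℝ}

theorem norm_comp_iterate_le (hf : MovesRight f R) (hR : 1 ≤ R) (hδ : 0 < δ) (hC : 0 ≤ C)
    (hh : ∀ y ∈ halfPlane R, ‖h y‖ ≤ C * y.re ^ (-(1 + δ))) {y : ℂ} (hy : y ∈ halfPlane R) (l : ℕ) :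
    ‖h (f^[l] y)‖ ≤ C * (1 + (l : ℝ) / 2) ^ (-(1 + δ)) := by
  refine (hh _ (hf.iterate_mem hy l)).trans ?_
  have := hf.le_re_iterate hy l
  have hy' : R < y.re := hy
  gcongr ?_ * ?_
  exact Real.rpow_le_rpow_of_nonpos (by positivity) (by linarith) (by linarith)

theorem summable_comp_iterate (hf : MovesRight f R) (hR : 1 ≤ R) (hδ : 0 < δ) (hC : 0 ≤ C)
    (hh : ∀ y ∈ halfPlane R, ‖h y‖ ≤ C * y.re ^ (-(1 + δ))) {y : ℂ} (hy : y ∈ halfPlane R) :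
    Summable (fun l : ℕ => h (f^[l] y)) :=
  Summable.of_norm_bounded ((summable_rate hδ).mul_left C) (norm_comp_iterate_le hf hR hδ hC hh hy)

theorem cohomSol_comp (hf : MovesRight f R) (hR : 1 ≤ R) (hδ : 0 < δ) (hC : 0 ≤ C)
    (hh : ∀ y ∈ halfPlane R, ‖h y‖ ≤ C * y.re ^ (-(1 + δ))) {y : ℂ} (hy : y ∈ halfPlane R) :
    cohomSol f h (f y) = cohomSol f h y + h y := by
  have := (summable_comp_iterate hf hR hδ hC hh hy).tsum_eq_zero_add
  simp only [cohomSol, this, Function.iterate_succ_apply, Function.iterate_zero, id_eq]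
  ring

theorem norm_cohomSol_le (hf : MovesRight f R) (hR : 1 ≤ R) (hδ : 0 < δ) (hC : 0 ≤ C)
    (hh : ∀ y ∈ halfPlane R, ‖h y‖ ≤ C * y.re ^ (-(1 + δ))) {y : ℂ} (hy : y ∈ halfPlane R) :
    ‖cohomSol f h y‖ ≤ ∑' l : ℕ, C * (1 + (l : ℝ) / 2) ^ (-(1 + δ)) := by
  rw [cohomSol, norm_neg]
  exact tsum_of_norm_bounded ((summable_rate hδ).mul_left C).hasSum
    (norm_comp_iterate_le hf hR hδ hC hh hy)

theorem differentiableOn_cohomSol (hf : MovesRight f R) (hR : 1 ≤ R) (hδ : 0 < δ) (hC : 0 ≤ C)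
    (hd : DifferentiableOn ℂ h (halfPlane R))
    (hh : ∀ y ∈ halfPlane R, ‖h y‖ ≤ C * y.re ^ (-(1 + δ))) :
    DifferentiableOn ℂ (cohomSol f h) (halfPlane R) := by
  refine DifferentiableOn.neg (Complex.differentiableOn_tsum_of_summable_norm
    ((summable_rate hδ).mul_left C) (fun l => ?_) (isOpen_halfPlane R)
    (fun l y hy => norm_comp_iterate_le hf hR hδ hC hh hy l))
  exact hd.comp (hf.differentiableOn_iterate l) (hf.mapsTo.iterate l)

end Cohom

/-- `f` is holomorphic and `f y = y + 1 + O((Re y)^{-δ})` on the half plane `{R < Re y}`. -/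
structure NearTranslation (f : ℂ → ℂ) (R C δ : ℝ) : Prop where
  one_le : 1 ≤ R
  delta_pos : 0 < δ
  C_nonneg : 0 ≤ C
  differentiableOn : DifferentiableOn ℂ f (halfPlane R)
  bound : ∀ y ∈ halfPlane R, ‖f y - y - 1‖ ≤ C * y.re ^ (-δ)

namespace NearTranslation

variable {f : ℂ → ℂ} {R C δ : ℝ}

theorem exists_movesRight (hf : NearTranslation f R C δ) : ∃ R₁, R ≤ R₁ ∧ MovesRight f R₁ := by
  have h : Tendsto (fun t : ℝ => C * t ^ (-δ)) atTop (𝓝 (C * 0)) :=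
    (tendsto_rpow_neg_atTop hf.delta_pos).const_mul C
  rw [mul_zero] at h
  obtain ⟨T, hT⟩ := eventually_atTop.1 (h.eventually (ge_mem_nhds (show (0 : ℝ) < 1 / 2 by norm_num)))
  refine ⟨max R T, le_max_left _ _, hf.differentiableOn.mono (halfPlane_subset (le_max_left _ _)),
    fun y hy => ?_⟩
  have hy' : max R T < y.re := hy
  have h1 := hf.bound y (halfPlane_subset (le_max_left _ _) hy)
  have h2 := hT y.re (le_of_lt (lt_of_le_of_lt (le_max_right _ _) hy'))
  have h3 := Complex.abs_re_le_norm (f y - y - 1)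
  simp only [Complex.sub_re, Complex.one_re] at h3
  have := (abs_le.1 (h3.trans (h1.trans h2))).1
  linarith

theorem norm_deriv_error_le (hf : NearTranslation f R C δ) {t : ℝ} (ht : 4 * R ≤ t) {w : ℂ}
    (hw : t ≤ w.re) :
    ‖deriv (fun y => f y - y - 1) w‖ ≤ C * 2 ^ (1 + δ) * t ^ (-(1 + δ)) := by
  have hR := hf.one_le
  have hδ := hf.delta_pos
  have hC := hf.C_nonneg
  have hre : ∀ z ∈ Metric.closedBall w (t / 2), t / 2 ≤ z.re := by
    intro z hz
    rw [Metric.mem_closedBall, dist_eq_norm] at hz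
    have := (abs_le.1 ((Complex.abs_re_le_norm (z - w)).trans hz)).1
    rw [Complex.sub_re] at this
    linarith
  have hmem : Metric.closedBall w (t / 2) ⊆ halfPlane R := by
    intro z hz
    have := hre z hz
    change R < z.re
    linarith
  have hd : DiffContOnCl ℂ (fun y => f y - y - 1) (Metric.ball w (t / 2)) := by
    apply DifferentiableOn.diffContOnCl
    refine DifferentiableOn.mono ?_ (Metric.closure_ball_subset_closedBall.trans hmem)
    exact (hf.differentiableOn.sub differentiableOn_id).sub (differentiableOn_const _)
  have key := Complex.norm_deriv_le_of_forall_mem_sphere_norm_le (C := C * (t / 2) ^ (-δ))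
    (show 0 < t / 2 by linarith) hd (fun z hz => by
      have hz' := Metric.sphere_subset_closedBall hz
      refine (hf.bound z (hmem hz')).trans ?_
      gcongr ?_ * ?_
      exact Real.rpow_le_rpow_of_nonpos (by linarith) (hre z hz') (by linarith))
  refine key.trans (le_of_eq ?_)
  have ht0 : 0 < t := by linarith
  have e1 : (t / 2) ^ (-δ) / (t / 2) = (t / 2) ^ (-(1 + δ)) := by
    rw [show -(1 + δ) = -δ - 1 by ring, Real.rpow_sub_one (by positivity)]
  rw [mul_div_assoc, e1, Real.div_rpow ht0.le (by norm_num), Real.rpow_neg (by norm_num : (0:ℝ) ≤ 2),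
    div_inv_eq_mul]
  ring

theorem norm_error_sub_le (hf : NearTranslation f R C δ) {t : ℝ} (ht : 4 * R ≤ t) {w w' : ℂ}
    (hw : t ≤ w.re) (hw' : t ≤ w'.re) :
    ‖(f w - w - 1) - (f w' - w' - 1)‖ ≤ C * 2 ^ (1 + δ) * t ^ (-(1 + δ)) * ‖w - w'‖ := by
  have hR := hf.one_le
  have hconv : Convex ℝ {z : ℂ | t ≤ z.re} := convex_halfSpace_re_ge t
  refine hconv.norm_image_sub_le_of_norm_deriv_le (𝕜 := ℂ) (f := fun y => f y - y - 1) (fun z hz => ?_)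
    (fun z hz => hf.norm_deriv_error_le ht hz) hw' hw
  have hz' : z ∈ halfPlane R := by
    change R < z.re
    have : t ≤ z.re := hz
    linarith
  have := (hf.differentiableOn z hz').differentiableAt ((isOpen_halfPlane R).mem_nhds hz')
  fun_prop

/-- On a half plane far to the right, all iterates are uniformly Lipschitz, and the errors along
two orbits differ summably. -/
theorem exists_rate (hf : NearTranslation f R C δ) (R₀ : ℝ) :
    ∃ R₁, R₀ ≤ R₁ ∧ R ≤ R₁ ∧ MovesRight f R₁ ∧ ∃ κ : ℕ → ℝ, Summable κ ∧ (∑' l, κ l ≤ 1 / 2) ∧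
      ∀ y ∈ halfPlane R₁, ∀ y' ∈ halfPlane R₁, ∀ l : ℕ,
        ‖(f (f^[l] y) - f^[l] y - 1) - (f (f^[l] y') - f^[l] y' - 1)‖ ≤ κ l * ‖y - y'‖ := by
  have hR := hf.one_le
  have hδ := hf.delta_pos
  have hC := hf.C_nonneg
  obtain ⟨R₂, hR₂, hmove⟩ := hf.exists_movesRight
  set K := C * 2 ^ (1 + δ) with hK
  have hK0 : 0 ≤ K := by positivity
  set S := ∑' l : ℕ, (1 + (l : ℝ) / 2) ^ (-(1 + δ / 2)) with hS
  have hsum := summable_rate (half_pos hδ)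
  have h : Tendsto (fun t : ℝ => K * S * t ^ (-(δ / 2))) atTop (𝓝 (K * S * 0)) :=
    (tendsto_rpow_neg_atTop (half_pos hδ)).const_mul _
  rw [mul_zero] at h
  obtain ⟨T, hT⟩ := eventually_atTop.1 (h.eventually (ge_mem_nhds (show (0 : ℝ) < 1 / 4 by norm_num)))
  set R₁ := max (max R₀ (4 * R)) (max R₂ T) with hR₁
  have h1 : R₀ ≤ R₁ := (le_max_left _ _).trans (le_max_left _ _)
  have h2 : 4 * R ≤ R₁ := (le_max_right _ _).trans (le_max_left _ _)
  have h3 : R₂ ≤ R₁ := (le_max_left _ _).trans (le_max_right _ _)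
  have h4 : T ≤ R₁ := (le_max_right _ _).trans (le_max_right _ _)
  have hm := hmove.mono h3
  set κ : ℕ → ℝ := fun l => K * (R₁ ^ (-(δ / 2)) * (1 + (l : ℝ) / 2) ^ (-(1 + δ / 2))) with hκ
  have hκs : Summable κ := (hsum.mul_left _).mul_left _
  have hR₁0 : 0 < R₁ := by linarith
  have hκ0 : ∀ l, 0 ≤ κ l := fun l => by positivity
  have hκsum : ∑' l, κ l ≤ 1 / 4 := by
    rw [tsum_mul_left, tsum_mul_left]
    have := hT R₁ h4
    calc K * (R₁ ^ (-(δ / 2)) * S) = K * S * R₁ ^ (-(δ / 2)) := by ring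
      _ ≤ 1 / 4 := this
  have hstep : ∀ y ∈ halfPlane R₁, ∀ y' ∈ halfPlane R₁, ∀ l : ℕ,
      ‖(f (f^[l] y) - f^[l] y - 1) - (f (f^[l] y') - f^[l] y' - 1)‖
        ≤ κ l * ‖f^[l] y - f^[l] y'‖ := by
    intro y hy y' hy' l
    have a1 := hm.le_re_iterate hy l
    have a2 := hm.le_re_iterate hy' l
    have b1 : R₁ < y.re := hy
    have b2 : R₁ < y'.re := hy'
    have hl : (0 : ℝ) ≤ l := by positivity
    refine (hf.norm_error_sub_le (t := R₁ + l / 2) (by linarith) (by linarith) (by linarith)).trans ?_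
    gcongr ?_ * _
    exact mul_le_mul_of_nonneg_left (rate_le hδ (show 1 ≤ R₁ by linarith) l) hK0
  have hlip : ∀ y ∈ halfPlane R₁, ∀ y' ∈ halfPlane R₁, ∀ l : ℕ,
      ‖f^[l] y - f^[l] y'‖ ≤ (1 + 2 * ∑ i ∈ Finset.range l, κ i) * ‖y - y'‖ := by
    intro y hy y' hy' l
    induction l with
    | zero => simp
    | succ l ih =>
      have e : f^[l + 1] y - f^[l + 1] y' = (f^[l] y - f^[l] y')
          + ((f (f^[l] y) - f^[l] y - 1) - (f (f^[l] y') - f^[l] y' - 1)) := by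
        rw [Function.iterate_succ_apply', Function.iterate_succ_apply']
        ring
      have hs : ∑ i ∈ Finset.range l, κ i ≤ 1 / 4 :=
        (hκs.sum_le_tsum _ fun i _ => hκ0 i).trans hκsum
      rw [e, Finset.sum_range_succ]
      have i1 := norm_add_le (f^[l] y - f^[l] y')
        ((f (f^[l] y) - f^[l] y - 1) - (f (f^[l] y') - f^[l] y' - 1))
      have i2 := hstep y hy y' hy' l
      have i3 : κ l * ‖f^[l] y - f^[l] y'‖ ≤ κ l * (2 * ‖y - y'‖) := by
        refine mul_le_mul_of_nonneg_left (ih.trans ?_) (hκ0 l)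
        gcongr
        linarith
      linarith
  refine ⟨R₁, h1, by linarith, hm, fun l => 2 * κ l, hκs.mul_left 2, ?_, ?_⟩
  · rw [tsum_mul_left]
    linarith
  · intro y hy y' hy' l
    have hs : ∑ i ∈ Finset.range l, κ i ≤ 1 / 4 :=
      (hκs.sum_le_tsum _ fun i _ => hκ0 i).trans hκsum
    refine (hstep y hy y' hy' l).trans ?_
    have : ‖f^[l] y - f^[l] y'‖ ≤ 2 * ‖y - y'‖ := by
      refine (hlip y hy y' hy' l).trans ?_
      gcongr
      linarith
    have := mul_le_mul_of_nonneg_left this (hκ0 l)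
    linarith

/-- The Fatou coordinate. -/
theorem exists_fatou_coordinate (hf : NearTranslation f R C δ) (R₀ : ℝ) :
    ∃ R₁, R₀ ≤ R₁ ∧ MovesRight f R₁ ∧ ∃ Ψ : ℂ → ℂ, DifferentiableOn ℂ Ψ (halfPlane R₁) ∧
      (∀ y ∈ halfPlane R₁, Ψ (f y) = Ψ y + 1) ∧
      (∀ y ∈ halfPlane R₁, ∀ y' ∈ halfPlane R₁,
        ‖Ψ y - Ψ y' - (y - y')‖ ≤ 1 / 2 * ‖y - y'‖) := by
  obtain ⟨R₁, h0, h1, hm, κ, hκ, hκsum, hstep⟩ := hf.exists_rate R₀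
  set r : ℂ → ℂ := fun y => f y - y - 1 with hr
  set b : ℂ := ((R₁ + 1 : ℝ) : ℂ) with hb
  have hbm : b ∈ halfPlane R₁ := by
    change R₁ < b.re
    rw [hb, Complex.ofReal_re]
    linarith
  have hstep' : ∀ y ∈ halfPlane R₁, ∀ y' ∈ halfPlane R₁, ∀ l : ℕ,
      ‖r (f^[l] y) - r (f^[l] y')‖ ≤ κ l * ‖y - y'‖ := hstep
  have hsm : ∀ y ∈ halfPlane R₁, ∀ y' ∈ halfPlane R₁,
      Summable (fun l : ℕ => r (f^[l] y) - r (f^[l] y')) := fun y hy y' hy' =>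
    Summable.of_norm_bounded (hκ.mul_right _) (hstep' y hy y' hy')
  have hto : ∀ y ∈ halfPlane R₁, Tendsto (fun l : ℕ => r (f^[l] y)) atTop (𝓝 0) := by
    intro y hy
    have hre : Tendsto (fun l : ℕ => (f^[l] y).re) atTop atTop := by
      refine tendsto_atTop_mono (hm.le_re_iterate hy) ?_
      exact tendsto_atTop_add_const_left _ _ (tendsto_natCast_atTop_atTop.atTop_div_const (by norm_num))
    have := ((tendsto_rpow_neg_atTop hf.delta_pos).comp hre).const_mul C
    rw [mul_zero] at this
    exact squeeze_zero_norm (fun l => hf.bound _ (halfPlane_subset h1 (hm.iterate_mem hy l))) this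
  refine ⟨R₁, h0, hm, fun y => y + ∑' l : ℕ, (r (f^[l] y) - r (f^[l] b)), ?_, ?_, ?_⟩
  · refine DifferentiableOn.add differentiableOn_id ?_
    intro y hy
    have hopen : IsOpen (halfPlane R₁ ∩ Metric.ball b (‖y - b‖ + 1)) :=
      (isOpen_halfPlane R₁).inter Metric.isOpen_ball
    have hy2 : y ∈ halfPlane R₁ ∩ Metric.ball b (‖y - b‖ + 1) :=
      ⟨hy, by rw [Metric.mem_ball, dist_eq_norm]; linarith⟩
    have hrd : DifferentiableOn ℂ r (halfPlane R) :=
      (hf.differentiableOn.sub differentiableOn_id).sub (differentiableOn_const _)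
    have := Complex.differentiableOn_tsum_of_summable_norm (hκ.mul_right (‖y - b‖ + 1))
      (F := fun (l : ℕ) y => r (f^[l] y) - r (f^[l] b)) (fun l => ?_) hopen (fun l w hw => ?_)
    · exact ((this y hy2).differentiableAt (hopen.mem_nhds hy2)).differentiableWithinAt
    · refine DifferentiableOn.sub_const (DifferentiableOn.mono ?_ inter_subset_left) _
      exact (hrd.mono (halfPlane_subset h1)).comp (hm.differentiableOn_iterate l)
        (hm.mapsTo.iterate l)
    · have hκl : 0 ≤ κ l := by
        have h2 : b + 1 ∈ halfPlane R₁ := by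
          change R₁ < (b + 1).re
          rw [hb, Complex.add_re, Complex.ofReal_re, Complex.one_re]
          linarith
        have := (norm_nonneg _).trans (hstep' (b + 1) h2 b hbm l)
        simpa using this
      refine (hstep' w hw.1 b hbm l).trans (mul_le_mul_of_nonneg_left ?_ hκl)
      have := hw.2
      rw [Metric.mem_ball, dist_eq_norm] at this
      exact this.le
  · intro y hy
    have hfy := hm.mapsTo hy
    have e1 : ∑' l : ℕ, (r (f^[l] (f y)) - r (f^[l] y)) = - r y := by
      have t1 := (hsm _ hfy y hy).hasSum.tendsto_sum_nat
      refine tendsto_nhds_unique t1 ?_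
      have : (fun N : ℕ => ∑ l ∈ Finset.range N, (r (f^[l] (f y)) - r (f^[l] y)))
          = fun N => r (f^[N] y) - r y := by
        funext N
        have := Finset.sum_range_sub (fun l => r (f^[l] y)) N
        simpa [Function.iterate_succ_apply] using this
      rw [this]
      simpa using (hto y hy).sub_const (r y)
    have e2 : ∑' l : ℕ, (r (f^[l] (f y)) - r (f^[l] b))
        = ∑' l : ℕ, (r (f^[l] (f y)) - r (f^[l] y)) + ∑' l : ℕ, (r (f^[l] y) - r (f^[l] b)) := by
      rw [← (hsm _ hfy y hy).tsum_add (hsm y hy b hbm)]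
      congr 1
      funext l
      ring
    change f y + ∑' l : ℕ, (r (f^[l] (f y)) - r (f^[l] b)) = _
    rw [e2, e1, hr]
    ring
  · intro y hy y' hy'
    have e : y + ∑' l : ℕ, (r (f^[l] y) - r (f^[l] b)) - (y' + ∑' l : ℕ, (r (f^[l] y') - r (f^[l] b)))
        - (y - y') = ∑' l : ℕ, (r (f^[l] y) - r (f^[l] y')) := by
      have : ∑' l : ℕ, (r (f^[l] y) - r (f^[l] y'))
          = ∑' l : ℕ, (r (f^[l] y) - r (f^[l] b)) - ∑' l : ℕ, (r (f^[l] y') - r (f^[l] b)) := by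
        rw [← (hsm y hy b hbm).tsum_sub (hsm y' hy' b hbm)]
        congr 1
        funext l
        ring
      rw [this]
      ring
    dsimp only
    rw [e]
    refine (tsum_of_norm_bounded (hκ.mul_right _).hasSum (hstep' y hy y' hy')).trans ?_
    rw [tsum_mul_right]
    gcongr

/-- The inverse of the Fatou coordinate, on a horizontal half strip. -/
theorem exists_fatou_parametrization (hf : NearTranslation f R C δ) (R₀ : ℝ) :
    ∃ R₁, R₀ ≤ R₁ ∧ MovesRight f R₁ ∧ ∃ (R' : ℝ) (χ : ℂ → ℂ),
      DifferentiableOn ℂ χ (halfStrip R') ∧ MapsTo χ (halfStrip R') (halfPlane R₁) ∧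
      InjOn χ (halfStrip R') ∧ (∀ ψ ∈ halfStrip R', deriv χ ψ ≠ 0) ∧
      ∀ ψ ∈ halfStrip R', χ (ψ + 1) = f (χ ψ) := by
  obtain ⟨R₁, h0, hm, Ψ, hΨd, hΨ1, hΨ⟩ := hf.exists_fatou_coordinate R₀
  have happ : ApproximatesLinearOn Ψ ((ContinuousLinearEquiv.refl ℂ ℂ : ℂ ≃L[ℂ] ℂ) : ℂ →L[ℂ] ℂ)
      (halfPlane R₁) (1 / 2) := by
    intro y hy y' hy'
    simpa using hΨ y hy y' hy'
  have hnn : ‖(((ContinuousLinearEquiv.refl ℂ ℂ).symm : ℂ ≃L[ℂ] ℂ) : ℂ →L[ℂ] ℂ)‖₊ = 1 := by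
    simp
  have hc : Subsingleton ℂ ∨ (1 / 2 : NNReal) <
      ‖(((ContinuousLinearEquiv.refl ℂ ℂ).symm : ℂ ≃L[ℂ] ℂ) : ℂ →L[ℂ] ℂ)‖₊⁻¹ := by
    right
    rw [hnn, inv_one]
    exact NNReal.half_lt_self one_ne_zero
  set e := happ.toOpenPartialHomeomorph Ψ _ hc (isOpen_halfPlane R₁) with he
  have hec : ∀ y, e y = Ψ y := fun y => rfl
  set b : ℂ := ((R₁ + 1 : ℝ) : ℂ) with hb
  have hbre : b.re = R₁ + 1 := by rw [hb, Complex.ofReal_re]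
  have hbm : b ∈ halfPlane R₁ := by
    change R₁ < b.re
    linarith
  have hiter : ∀ N : ℕ, Ψ (f^[N] b) = Ψ b + N := by
    intro N
    induction N with
    | zero => simp
    | succ N ih =>
      rw [Function.iterate_succ_apply', hΨ1 _ (hm.iterate_mem hbm N), ih]
      push_cast
      ring
  have htarget : ∀ ψ ∈ halfStrip 8, ψ + Ψ b ∈ e.target := by
    intro ψ hψ
    obtain ⟨N, hN⟩ : ∃ N : ℕ, N = ⌊ψ.re⌋₊ := ⟨_, rfl⟩
    have h8 : (8 : ℝ) < ψ.re := hψ.1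
    have hN1 : (N : ℝ) ≤ ψ.re := hN ▸ Nat.floor_le (by linarith)
    have hN2 : ψ.re < N + 1 := hN ▸ Nat.lt_floor_add_one ψ.re
    have hN8 : (8 : ℝ) ≤ N := by
      have : 8 ≤ N := by
        rw [hN]
        exact Nat.le_floor (by exact_mod_cast h8.le)
      exact_mod_cast this
    have hsub : Metric.closedBall (f^[N] b) ((N : ℝ) / 2) ⊆ halfPlane R₁ := by
      intro z hz
      rw [Metric.mem_closedBall, dist_eq_norm] at hz
      have h1 := (abs_le.1 ((Complex.abs_re_le_norm _).trans hz)).1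
      have h2 := hm.le_re_iterate hbm N
      rw [Complex.sub_re] at h1
      change R₁ < z.re
      linarith
    refine happ.closedBall_subset_target hc (isOpen_halfPlane R₁) (ε := (N : ℝ) / 2) (by positivity)
      hsub ?_
    rw [hiter, Metric.mem_closedBall, dist_eq_norm, add_comm ψ, add_sub_add_left_eq_sub]
    have h3 : ‖ψ - N‖ ≤ |(ψ - N).re| + |(ψ - N).im| := Complex.norm_le_abs_re_add_abs_im _
    have h4 : |(ψ - N).re| ≤ 1 := by
      rw [Complex.sub_re, Complex.natCast_re, abs_le]
      constructor <;> linarith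
    have h5 : |(ψ - N).im| ≤ 1 := by
      rw [Complex.sub_im, Complex.natCast_im, sub_zero]
      exact hψ.2.le
    have h6 : ((‖(((ContinuousLinearEquiv.refl ℂ ℂ).symm : ℂ ≃L[ℂ] ℂ) : ℂ →L[ℂ] ℂ)‖₊ : ℝ)⁻¹
        - ((1 / 2 : NNReal) : ℝ)) * ((N : ℝ) / 2) = N / 4 := by
      rw [hnn]
      push_cast
      ring
    refine le_trans ?_ h6.ge
    linarith
  have hsource : ∀ ψ ∈ halfStrip 8, e.symm (ψ + Ψ b) ∈ halfPlane R₁ := fun ψ hψ =>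
    e.map_target (htarget ψ hψ)
  have hderiv : ∀ y ∈ halfPlane R₁, deriv Ψ y ≠ 0 := by
    intro y hy h
    have hd := (hΨd.differentiableAt ((isOpen_halfPlane R₁).mem_nhds hy)).hasDerivAt.sub
      (hasDerivAt_id y)
    have := hd.le_of_lip' (C := 1 / 2) (by norm_num) (by
      filter_upwards [(isOpen_halfPlane R₁).mem_nhds hy] with z hz
      have e3 : Ψ z - z - (Ψ y - y) = Ψ z - Ψ y - (z - y) := by ring
      simpa only [Pi.sub_apply, id_eq, e3] using hΨ z hz y hy)
    rw [h] at this
    norm_num at this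
  have hχ : ∀ ψ ∈ halfStrip 8, HasDerivAt (fun ψ => e.symm (ψ + Ψ b))
      (deriv Ψ (e.symm (ψ + Ψ b)))⁻¹ ψ := by
    intro ψ hψ
    refine HasDerivAt.comp_add_const _ _ (e.hasDerivAt_symm (htarget ψ hψ)
      (hderiv _ (hsource ψ hψ)) ?_)
    exact (hΨd.differentiableAt ((isOpen_halfPlane R₁).mem_nhds (hsource ψ hψ))).hasDerivAt
  refine ⟨R₁, h0, hm, 8, fun ψ => e.symm (ψ + Ψ b), ?_, hsource, ?_, ?_, ?_⟩
  · exact fun ψ hψ => (hχ ψ hψ).differentiableAt.differentiableWithinAt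
  · intro ψ hψ ψ' hψ' h
    exact add_right_cancel (e.symm.injOn (htarget ψ hψ) (htarget ψ' hψ') h)
  · intro ψ hψ
    rw [(hχ ψ hψ).deriv]
    exact inv_ne_zero (hderiv _ (hsource ψ hψ))
  · intro ψ hψ
    have h1 : ψ + 1 ∈ halfStrip 8 := by
      refine ⟨?_, ?_⟩
      · rw [Complex.add_re, Complex.one_re]
        linarith [hψ.1]
      · rw [Complex.add_im, Complex.one_im, add_zero]
        exact hψ.2
    refine e.injOn (hsource _ h1) (hm.mapsTo (hsource ψ hψ)) ?_
    have h2 : Ψ (e.symm (ψ + Ψ b)) = ψ + Ψ b := e.right_inv (htarget ψ hψ)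
    rw [e.right_inv (htarget _ h1), hec, hΨ1 _ (hsource ψ hψ), h2]
    ring

end NearTranslation

theorem nearTranslation_mul_exp {x : ℂ → ℂ} {R C δ : ℝ} (hδ : 0 < δ) (hδ1 : δ ≤ 1) (hC : 0 ≤ C)
    (hx : DifferentiableOn ℂ x (halfPlane R))
    (hb : ∀ y ∈ halfPlane R, ‖x y - 1 / y‖ ≤ C * ‖y‖ ^ (-(1 + δ))) {R' : ℝ} (hR : R ≤ R')
    (hR' : 1 + C ≤ R') :
    NearTranslation (fun y => y * Complex.exp (x y)) R' ((1 + C) ^ 2 + C) δ ∧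
      ∀ y ∈ halfPlane R', ‖x y‖ ≤ 1 := by
  have hxb : ∀ y ∈ halfPlane R', ‖x y‖ ≤ (1 + C) * ‖y‖⁻¹ ∧ ‖x y‖ ≤ 1 := by
    intro y hy
    have hy1 : R' < y.re := hy
    have hyn : 1 + C < ‖y‖ := hR'.trans_lt (hy1.trans_le (Complex.re_le_norm y))
    have h1 := hb y (halfPlane_subset hR hy)
    have h2 : ‖x y‖ ≤ ‖x y - 1 / y‖ + ‖y‖⁻¹ := by
      have := norm_add_le (x y - 1 / y) (1 / y)
      rwa [sub_add_cancel, norm_div 1 y, norm_one, one_div ‖y‖] at this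
    have h3 : ‖y‖ ^ (-(1 + δ)) ≤ ‖y‖⁻¹ := by
      rw [← Real.rpow_neg_one]
      exact Real.rpow_le_rpow_of_exponent_le (by linarith) (by linarith)
    have h4 : ‖x y‖ ≤ (1 + C) * ‖y‖⁻¹ := by
      have := mul_le_mul_of_nonneg_left h3 hC
      linarith
    refine ⟨h4, h4.trans ?_⟩
    rw [← div_eq_mul_inv, div_le_one (by linarith)]
    exact hyn.le
  refine ⟨⟨by linarith, hδ, by positivity, ?_, ?_⟩, fun y hy => (hxb y hy).2⟩
  · have := hx.mono (halfPlane_subset hR)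
    fun_prop
  · intro y hy
    have hy1 : R' < y.re := hy
    have hre := Complex.re_le_norm y
    have hyn : 1 + C < ‖y‖ := hR'.trans_lt (hy1.trans_le hre)
    have hy0 : y ≠ 0 := norm_pos_iff.1 (by linarith)
    obtain ⟨h1, h2⟩ := hxb y hy
    have e : y * Complex.exp (x y) - y - 1
        = y * (Complex.exp (x y) - 1 - x y) + y * (x y - 1 / y) := by
      field_simp
      ring
    have h3 : ‖y * (Complex.exp (x y) - 1 - x y)‖ ≤ (1 + C) ^ 2 * ‖y‖ ^ (-δ) := by
      rw [norm_mul]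
      calc ‖y‖ * ‖Complex.exp (x y) - 1 - x y‖ ≤ ‖y‖ * ((1 + C) * ‖y‖⁻¹) ^ 2 := by
            gcongr
            exact (Complex.norm_exp_sub_one_sub_id_le h2).trans (by gcongr)
        _ = (1 + C) ^ 2 * ‖y‖ ^ (-1 : ℝ) := by
            rw [Real.rpow_neg_one]
            field_simp
        _ ≤ (1 + C) ^ 2 * ‖y‖ ^ (-δ) := by
            gcongr ?_ * ?_
            exact Real.rpow_le_rpow_of_exponent_le (by linarith) (by linarith)
    have h4 : ‖y * (x y - 1 / y)‖ ≤ C * ‖y‖ ^ (-δ) := by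
      rw [norm_mul]
      calc ‖y‖ * ‖x y - 1 / y‖ ≤ ‖y‖ * (C * ‖y‖ ^ (-(1 + δ))) := by
            gcongr
            exact hb y (halfPlane_subset hR hy)
        _ = C * ‖y‖ ^ (-δ) := by
            rw [show -δ = -(1 + δ) + 1 by ring, Real.rpow_add_one (by linarith)]
            ring
    have h5 : ‖y‖ ^ (-δ) ≤ y.re ^ (-δ) :=
      Real.rpow_le_rpow_of_nonpos (by linarith) hre (by linarith)
    calc ‖y * Complex.exp (x y) - y - 1‖ ≤ (1 + C) ^ 2 * ‖y‖ ^ (-δ) + C * ‖y‖ ^ (-δ) := by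
          rw [e]
          exact (norm_add_le _ _).trans (add_le_add h3 h4)
      _ = ((1 + C) ^ 2 + C) * ‖y‖ ^ (-δ) := by ring
      _ ≤ ((1 + C) ^ 2 + C) * y.re ^ (-δ) := by gcongr

/-- The logarithmic multipliers `L_j u = A_j u^k + O(u^{k+1})` of a normal form, as holomorphic
functions of the resonant monomial `u`. -/
structure LogMultipliers {ι : Type*} (A : ι → ℂ) (L : ι → ℂ → ℂ) (k : ℕ) (ρ C : ℝ) : Prop where
  one_le : 1 ≤ k
  rho_pos : 0 < ρ
  C_nonneg : 0 ≤ C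
  differentiableOn : ∀ j, DifferentiableOn ℂ (L j) (Metric.ball 0 ρ)
  bound : ∀ j, ∀ u ∈ Metric.ball (0 : ℂ) ρ, ‖L j u - A j * u ^ k‖ ≤ C * ‖u‖ ^ (k + 1)

theorem LogMultipliers.comp {ι κ : Type*} {A : ι → ℂ} {L : ι → ℂ → ℂ} {k : ℕ} {ρ C : ℝ}
    (h : LogMultipliers A L k ρ C) (e : κ → ι) :
    LogMultipliers (fun j => A (e j)) (fun j => L (e j)) k ρ C :=
  ⟨h.one_le, h.rho_pos, h.C_nonneg, fun j => h.differentiableOn (e j), fun j => h.bound (e j)⟩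

theorem norm_sum_sub_le {ι : Type*} [Fintype ι] {A : ι → ℂ} {L : ι → ℂ → ℂ} {k : ℕ} {ρ C : ℝ}
    (h : LogMultipliers A L k ρ C) (α : ι → ℕ) {u : ℂ} (hu : u ∈ Metric.ball (0 : ℂ) ρ) :
    ‖∑ j, α j * L j u - (∑ j, α j * A j) * u ^ k‖ ≤ (∑ j, (α j : ℝ)) * C * ‖u‖ ^ (k + 1) := by
  rw [Finset.sum_mul, ← Finset.sum_sub_distrib, Finset.sum_mul, Finset.sum_mul]
  refine norm_sum_le_of_le _ fun j _ => ?_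
  rw [mul_assoc (α j : ℂ), ← mul_sub, norm_mul, mul_assoc (α j : ℝ), Complex.norm_natCast]
  exact mul_le_mul_of_nonneg_left (h.bound j u hu) (by positivity)

theorem norm_root_mul_exp {τ y : ℂ} (hy : y ≠ 0) (k : ℕ) :
    ‖τ * Complex.exp (-Complex.log y / k)‖ = ‖τ‖ * ‖y‖ ^ (-(1 / (k : ℝ))) := by
  rw [norm_mul, Complex.norm_exp, Real.rpow_def_of_pos (norm_pos_iff.2 hy)]
  congr 2
  rw [show (k : ℂ) = ((k : ℝ) : ℂ) by simp, Complex.div_ofReal_re, Complex.neg_re, Complex.log_re]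
  ring

theorem log_mul_exp {y x : ℂ} (hy : 0 < y.re) (hx : ‖x‖ ≤ 1) :
    Complex.log (y * Complex.exp x) = Complex.log y + x := by
  have hy0 : y ≠ 0 := by
    rintro rfl
    simp at hy
  have h1 := abs_lt.1 (Complex.abs_arg_lt_pi_div_two_iff.2 (Or.inl hy))
  have h2 := abs_le.1 ((Complex.abs_im_le_norm x).trans hx)
  have h3 := Real.pi_gt_three
  have e : y * Complex.exp x = Complex.exp (Complex.log y + x) := by
    rw [Complex.exp_add, Complex.exp_log hy0]
  rw [e, Complex.log_exp]
  · rw [Complex.add_im, Complex.log_im]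
    linarith
  · rw [Complex.add_im, Complex.log_im]
    linarith

/-- Coordinates linearizing the logarithmic dynamics of a normal form over an attracting petal of
the resonant monomial: `w_j` are logarithms of the coordinates along one orbit for each `ψ`, the
time-one shift of `ψ` being the dynamics. -/
theorem exists_petal_coordinates {ι : Type*} [Fintype ι] {A : ι → ℂ} {L : ι → ℂ → ℂ} {k : ℕ}
    {ρ C : ℝ} (h : LogMultipliers A L k ρ C) (α : ι → ℕ) {Λ τ : ℂ} (hΛ : Λ = ∑ j, α j * A j)
    (hΛ0 : Λ ≠ 0) (hA : ∀ j, 0 < (A j / Λ).re) (hτ : k * Λ * τ ^ k = -1) (θ : ι → ℝ)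
    (hθ : ∑ j, α j * θ j = 0) (B : ℝ) :
    ∃ (R : ℝ) (w : ι → ℂ → ℂ) (Y : ℂ → ℂ),
      (∀ j, DifferentiableOn ℂ (w j) (halfStrip R)) ∧
      InjOn (fun ψ => Complex.exp (Y ψ)) (halfStrip R) ∧
      (∀ ψ ∈ halfStrip R, deriv Y ψ ≠ 0) ∧
      (∀ ψ ∈ halfStrip R, ∑ j, α j * w j ψ = Y ψ) ∧
      (∀ ψ ∈ halfStrip R, ∀ j,
        w j (ψ + 1) = w j ψ + Complex.I * θ j + L j (τ * Complex.exp (Y ψ))) ∧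
      (∀ ψ ∈ halfStrip R, ∀ j, (w j ψ).re ≤ B) ∧
      ∀ ψ ∈ halfStrip R, ∀ j, Tendsto (fun l : ℕ => (w j (ψ + l)).re) atTop atBot := by
  have hk := h.one_le
  have hkR : (0 : ℝ) < k := by exact_mod_cast hk
  have hkC : (k : ℂ) ≠ 0 := by
    have : k ≠ 0 := by omega
    exact_mod_cast this
  have hC := h.C_nonneg
  set δ : ℝ := 1 / k with hδ
  have hδ0 : 0 < δ := by positivity
  have hδ1 : δ ≤ 1 := by
    rw [hδ, div_le_one hkR]
    exact_mod_cast hk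
  set u : ℂ → ℂ := fun y => τ * Complex.exp (-Complex.log y / k) with hu
  set S : ℂ → ℂ := fun v => ∑ j, α j * L j v with hS
  set C' : ℝ := (∑ j, (α j : ℝ)) * C with hC'
  have hC'0 : 0 ≤ C' := by positivity
  set T : ℝ := ‖τ‖ ^ (k + 1) with hT
  have hT0 : 0 ≤ T := by positivity
  obtain ⟨R₀, hR₀1, hR₀⟩ : ∃ R₀ : ℝ, 1 ≤ R₀ ∧ ∀ y ∈ halfPlane R₀, u y ∈ Metric.ball (0 : ℂ) ρ := by
    have ht : Tendsto (fun t : ℝ => ‖τ‖ * t ^ (-δ)) atTop (𝓝 (‖τ‖ * 0)) :=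
      (tendsto_rpow_neg_atTop hδ0).const_mul _
    rw [mul_zero] at ht
    obtain ⟨t₀, ht₀⟩ := eventually_atTop.1 (ht.eventually (gt_mem_nhds h.rho_pos))
    refine ⟨max 1 t₀, le_max_left _ _, fun y hy => ?_⟩
    have hy1 : max 1 t₀ < y.re := hy
    have hy2 := max_lt_iff.1 (hy1.trans_le (Complex.re_le_norm y))
    rw [mem_ball_zero_iff, hu, norm_root_mul_exp (norm_pos_iff.1 (by linarith [hy2.1]))]
    exact ht₀ _ hy2.2.le
  have hpos : ∀ y ∈ halfPlane R₀, 0 < y.re := fun y hy => lt_of_lt_of_le (by linarith) (le_of_lt hy)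
  have hne : ∀ y ∈ halfPlane R₀, y ≠ 0 := by
    rintro y hy rfl
    simpa using hpos _ hy
  have hslit : ∀ y ∈ halfPlane R₀, y ∈ Complex.slitPlane := fun y hy => Or.inl (hpos y hy)
  have hud : DifferentiableOn ℂ u (halfPlane R₀) := by
    intro y hy
    have := (Complex.differentiableAt_log (hslit y hy))
    exact DifferentiableAt.differentiableWithinAt (by fun_prop)
  have hLd : ∀ j, DifferentiableOn ℂ (fun y => L j (u y)) (halfPlane R₀) := fun j =>
    (h.differentiableOn j).comp hud hR₀
  have hSd : DifferentiableOn ℂ (fun y => S (u y)) (halfPlane R₀) := by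
    simp only [hS]
    exact DifferentiableOn.fun_sum fun j _ => (hLd j).const_mul _
  have huk : ∀ y ∈ halfPlane R₀, u y ^ k = τ ^ k / y := by
    intro y hy
    have e : (k : ℂ) * (-Complex.log y / k) = -Complex.log y := by field_simp
    rw [hu, mul_pow, ← Complex.exp_nat_mul, e, Complex.exp_neg, Complex.exp_log (hne y hy),
      div_eq_mul_inv]
  have hun : ∀ y ∈ halfPlane R₀, ‖u y‖ ^ (k + 1) = T * ‖y‖ ^ (-(1 + δ)) := by
    intro y hy
    rw [hu, norm_root_mul_exp (hne y hy), mul_pow, ← Real.rpow_mul_natCast (norm_nonneg y)]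
    congr 2
    push_cast
    rw [hδ]
    field_simp
  have hS1 : ∀ y ∈ halfPlane R₀, ‖S (u y) - Λ * u y ^ k‖ ≤ C' * T * ‖y‖ ^ (-(1 + δ)) := by
    intro y hy
    have := norm_sum_sub_le h α (hR₀ y hy)
    rwa [hun y hy, ← hΛ, ← mul_assoc] at this
  set x : ℂ → ℂ := fun y => -k * S (u y) with hx
  have hxb : ∀ y ∈ halfPlane R₀, ‖x y - 1 / y‖ ≤ k * (C' * T) * ‖y‖ ^ (-(1 + δ)) := by
    intro y hy
    have e : x y - 1 / y = -k * (S (u y) - Λ * u y ^ k) := by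
      rw [huk y hy, hx, mul_sub, ← mul_div_assoc]
      linear_combination (-hτ) / y
    rw [e, norm_mul, norm_neg, Complex.norm_natCast, mul_assoc]
    exact mul_le_mul_of_nonneg_left (hS1 y hy) hkR.le
  obtain ⟨hnt, hx1⟩ := nearTranslation_mul_exp (R' := max R₀ (1 + k * (C' * T))) hδ0 hδ1
    (by positivity) (hSd.const_mul _) hxb (le_max_left _ _) (le_max_right _ _)
  set R₁ := max R₀ (1 + k * (C' * T)) with hR₁
  set f : ℂ → ℂ := fun y => y * Complex.exp (x y) with hf
  have hR₀₁ : R₀ ≤ R₁ := le_max_left _ _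
  set g : ι → ℂ → ℂ := fun j y => L j (u y) - A j / Λ * S (u y) with hg
  have hgd : ∀ j, DifferentiableOn ℂ (g j) (halfPlane R₀) := fun j =>
    (hLd j).sub (hSd.const_mul _)
  have hgb : ∀ j, ∀ y ∈ halfPlane R₀,
      ‖g j y‖ ≤ (C + ‖A j / Λ‖ * C') * T * y.re ^ (-(1 + δ)) := by
    intro j y hy
    have e : g j y = (L j (u y) - A j * u y ^ k) - A j / Λ * (S (u y) - Λ * u y ^ k) := by
      rw [hg]
      field_simp
      ring
    have h1 := h.bound j (u y) (hR₀ y hy)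
    rw [hun y hy] at h1
    have h2 := mul_le_mul_of_nonneg_left (hS1 y hy) (norm_nonneg (A j / Λ))
    have h3 : ‖y‖ ^ (-(1 + δ)) ≤ y.re ^ (-(1 + δ)) :=
      Real.rpow_le_rpow_of_nonpos (hpos y hy) (Complex.re_le_norm y) (by linarith)
    calc ‖g j y‖ ≤ C * (T * ‖y‖ ^ (-(1 + δ))) + ‖A j / Λ‖ * (C' * T * ‖y‖ ^ (-(1 + δ))) := by
          rw [e]
          refine (norm_sub_le _ _).trans (add_le_add h1 ?_)
          rwa [norm_mul]
      _ = (C + ‖A j / Λ‖ * C') * T * ‖y‖ ^ (-(1 + δ)) := by ring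
      _ ≤ _ := by gcongr
  have hgC : ∀ j, 0 ≤ (C + ‖A j / Λ‖ * C') * T := fun j => by positivity
  set c : ι → ℂ := fun j => A j / (k * Λ) with hc
  have hcre : ∀ j, 0 < (c j).re := by
    intro j
    have e : c j = A j / Λ / ((k : ℝ) : ℂ) := by
      rw [hc]
      push_cast
      field_simp
    rw [e, Complex.div_ofReal_re]
    exact div_pos (hA j) hkR
  set M : ι → ℝ := fun j => |θ j| + |(c j).im| * Real.pi
    + ∑' l : ℕ, (C + ‖A j / Λ‖ * C') * T * (1 + (l : ℝ) / 2) ^ (-(1 + δ)) with hM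
  obtain ⟨R₂, hR₂1, hR₂⟩ : ∃ R₂ : ℝ, R₁ ≤ R₂ ∧ ∀ t, R₂ ≤ t → ∀ j,
      M j - (c j).re * Real.log t ≤ B := by
    have : ∀ᶠ t : ℝ in atTop, ∀ j, M j - (c j).re * Real.log t ≤ B := by
      rw [eventually_all]
      intro j
      have := tendsto_atTop_add_const_left atTop (-M j)
        (Real.tendsto_log_atTop.const_mul_atTop (hcre j))
      filter_upwards [this.eventually_ge_atTop (-B)] with t ht
      linarith
    obtain ⟨t₀, ht₀⟩ := eventually_atTop.1 this
    exact ⟨max R₁ t₀, le_max_left _ _, fun t ht => ht₀ t ((le_max_right _ _).trans ht)⟩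
  obtain ⟨R, hR, hm, R', χ, hχd, hχm, hχi, hχ', hχf⟩ := hnt.exists_fatou_parametrization R₂
  have hR₁R : R₁ ≤ R := hR₂1.trans hR
  have hχ0 : ∀ ψ ∈ halfStrip R', χ ψ ∈ halfPlane R₀ := fun ψ hψ =>
    halfPlane_subset (hR₀₁.trans hR₁R) (hχm hψ)
  have hR1 : 1 ≤ R := hR₀1.trans (hR₀₁.trans hR₁R)
  have hsubR : halfPlane R ⊆ halfPlane R₀ := halfPlane_subset (hR₀₁.trans hR₁R)
  set w : ι → ℂ → ℂ := fun j ψ =>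
    Complex.I * θ j * ψ - c j * Complex.log (χ ψ) + cohomSol f (g j) (χ ψ) with hw
  set Y : ℂ → ℂ := fun ψ => -Complex.log (χ ψ) / k with hY
  have hlogd : DifferentiableOn ℂ (fun ψ => Complex.log (χ ψ)) (halfStrip R') :=
    hχd.clog fun ψ hψ => hslit _ (hχ0 ψ hψ)
  have hwre : ∀ ψ ∈ halfStrip R', ∀ j, (w j ψ).re ≤ M j - (c j).re * Real.log (χ ψ).re := by
    intro ψ hψ j
    have hy := hχ0 ψ hψ
    have h1 : (Complex.I * θ j * ψ).re ≤ |θ j| := by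
      have : (Complex.I * θ j * ψ).re = -(θ j * ψ.im) := by simp [Complex.mul_re]
      rw [this]
      refine (neg_le_abs _).trans ?_
      rw [abs_mul]
      exact mul_le_of_le_one_right (abs_nonneg _) hψ.2.le
    have h2 : -(c j * Complex.log (χ ψ)).re
        ≤ |(c j).im| * Real.pi - (c j).re * Real.log (χ ψ).re := by
      rw [Complex.mul_re, Complex.log_re, Complex.log_im]
      have i1 : (c j).im * (χ ψ).arg ≤ |(c j).im| * Real.pi := by
        refine (le_abs_self _).trans ?_
        rw [abs_mul]
        exact mul_le_mul_of_nonneg_left (Complex.abs_arg_le_pi _) (abs_nonneg _)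
      have i2 : (c j).re * Real.log (χ ψ).re ≤ (c j).re * Real.log ‖χ ψ‖ :=
        mul_le_mul_of_nonneg_left (Real.log_le_log (hpos _ hy) (Complex.re_le_norm _)) (hcre j).le
      linarith
    have h3 := (Complex.re_le_norm _).trans (norm_cohomSol_le hm hR1 hδ0 (hgC j)
      (fun y hy => hgb j y (hsubR hy)) (hχm hψ))
    rw [hw, Complex.add_re, Complex.sub_re]
    simp only [hM]
    linarith
  have hcsum : ∑ j, α j * c j = 1 / k := by
    have : ∀ j, (α j : ℂ) * c j = α j * A j * (1 / (k * Λ)) := fun j => by rw [hc]; ring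
    rw [Finset.sum_congr rfl fun j _ => this j, ← Finset.sum_mul, ← hΛ]
    field_simp
  refine ⟨R', w, Y, ?_, ?_, ?_, ?_, ?_, ?_, ?_⟩
  · intro j
    refine DifferentiableOn.add (DifferentiableOn.sub (by fun_prop) (hlogd.const_mul _)) ?_
    exact (differentiableOn_cohomSol hm hR1 hδ0 (hgC j) ((hgd j).mono hsubR)
      (fun y hy => hgb j y (hsubR hy))).comp hχd hχm
  · intro ψ hψ ψ' hψ' he
    have hexp : ∀ ψ ∈ halfStrip R', Complex.exp (Y ψ) ^ k = (χ ψ)⁻¹ := by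
      intro ψ hψ
      have e : (k : ℂ) * (-Complex.log (χ ψ) / k) = -Complex.log (χ ψ) := by field_simp
      rw [hY, ← Complex.exp_nat_mul, e, Complex.exp_neg, Complex.exp_log (hne _ (hχ0 ψ hψ))]
    refine hχi hψ hψ' (inv_injective ?_)
    rw [← hexp ψ hψ, ← hexp ψ' hψ']
    exact congrArg (· ^ k) he
  · intro ψ hψ
    have hd := (hχd.differentiableAt ((isOpen_halfStrip R').mem_nhds hψ)).hasDerivAt
    have := ((hd.clog (hslit _ (hχ0 ψ hψ))).neg.div_const (k : ℂ)).deriv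
    rw [hY]
    erw [this]
    exact div_ne_zero (neg_ne_zero.2 (div_ne_zero (hχ' ψ hψ) (hne _ (hχ0 ψ hψ)))) hkC
  · intro ψ hψ
    have hsum : ∑ j, (α j : ℂ) * cohomSol f (g j) (χ ψ) = 0 := by
      have hz : ∀ y, ∑ j, (α j : ℂ) * g j y = 0 := by
        intro y
        have e : ∀ j, (α j : ℂ) * g j y = α j * L j (u y) - α j * A j * (S (u y) / Λ) := by
          intro j
          rw [hg]
          ring
        rw [Finset.sum_congr rfl fun j _ => e j, Finset.sum_sub_distrib, ← Finset.sum_mul, ← hΛ,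
          mul_div_cancel₀ _ hΛ0, sub_self]
      have hs : ∀ j, Summable (fun l : ℕ => (α j : ℂ) * g j (f^[l] (χ ψ))) := fun j =>
        (summable_comp_iterate hm hR1 hδ0 (hgC j) (fun y hy => hgb j y (hsubR hy))
          (hχm hψ)).mul_left _
      simp only [cohomSol, mul_neg, ← tsum_mul_left]
      rw [Finset.sum_neg_distrib, ← Summable.tsum_finsetSum fun j _ => hs j]
      simp [hz]
    have hθ' : ∑ j, (α j : ℂ) * θ j = 0 := by exact_mod_cast hθ
    have e : ∀ j, (α j : ℂ) * w j ψ = α j * θ j * (Complex.I * ψ)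
        - α j * c j * Complex.log (χ ψ) + α j * cohomSol f (g j) (χ ψ) := fun j => by
      rw [hw]
      ring
    rw [Finset.sum_congr rfl fun j _ => e j, Finset.sum_add_distrib, Finset.sum_sub_distrib,
      ← Finset.sum_mul, ← Finset.sum_mul, hsum, hcsum, hθ', hY]
    ring
  · intro ψ hψ j
    have hy := hχm hψ
    have hlog : Complex.log (f (χ ψ)) = Complex.log (χ ψ) + x (χ ψ) :=
      log_mul_exp (hpos _ (hχ0 ψ hψ)) (hx1 _ (halfPlane_subset hR₁R hy))
    have hco := cohomSol_comp hm hR1 hδ0 (hgC j) (fun y hy => hgb j y (hsubR hy)) hy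
    have e1 : L j (τ * Complex.exp (Y ψ)) = g j (χ ψ) - c j * x (χ ψ) := by
      simp only [hg, hc, hx, hY, hu]
      field_simp
      ring
    rw [e1]
    simp only [hw]
    rw [hχf ψ hψ, hlog, hco]
    ring
  · exact fun ψ hψ j => (hwre ψ hψ j).trans (hR₂ _ (hR.trans (le_of_lt (hχm hψ))) j)
  · intro ψ hψ j
    have hstrip : ∀ l : ℕ, ψ + l ∈ halfStrip R' ∧ χ (ψ + l) = f^[l] (χ ψ) := by
      intro l
      induction l with
      | zero => simpa using hψ
      | succ l ih =>
        have e : ψ + ((l + 1 : ℕ) : ℂ) = ψ + l + 1 := by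
          push_cast
          ring
        rw [e, hχf _ ih.1, ih.2, Function.iterate_succ_apply']
        refine ⟨⟨?_, ?_⟩, rfl⟩
        · have := ih.1.1
          rw [Complex.add_re, Complex.one_re]
          linarith
        · rw [Complex.add_im, Complex.one_im, add_zero]
          exact ih.1.2
    refine tendsto_atBot_mono (fun l => hwre _ (hstrip l).1 j) ?_
    have hre : Tendsto (fun l : ℕ => (χ (ψ + l)).re) atTop atTop := by
      refine tendsto_atTop_mono (f := fun l : ℕ => (χ ψ).re + (l : ℝ) / 2) (fun l => ?_) ?_
      · rw [(hstrip l).2]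
        exact hm.le_re_iterate (hχm hψ) l
      · exact tendsto_atTop_add_const_left _ _
          (tendsto_natCast_atTop_atTop.atTop_div_const (by norm_num))
    exact tendsto_const_nhds.add_atBot (tendsto_neg_atTop_atBot.comp
      ((Real.tendsto_log_atTop.comp hre).const_mul_atTop (hcre j)))

theorem log_one_add_pow_mul {h : ℂ → ℂ} (hd : ∀ᶠ u in 𝓝 (0 : ℂ), DifferentiableAt ℂ h u) {k : ℕ}
    (hk : 1 ≤ k) : ∃ C : ℝ, 0 ≤ C ∧ ∀ᶠ u in 𝓝 (0 : ℂ),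
      DifferentiableAt ℂ (fun u => Complex.log (1 + u ^ k * h u)) u ∧
      ‖Complex.log (1 + u ^ k * h u) - h 0 * u ^ k‖ ≤ C * ‖u‖ ^ (k + 1) ∧
      Complex.exp (Complex.log (1 + u ^ k * h u)) = 1 + u ^ k * h u := by
  have h0 : DifferentiableAt ℂ h 0 := hd.self_of_nhds
  obtain ⟨K, hK0, hK⟩ := h0.isBigO_sub.exists_nonneg
  have hx0 : Tendsto (fun u : ℂ => u ^ k * h u) (𝓝 0) (𝓝 0) := by
    have h1 := h0.continuousAt
    have : ContinuousAt (fun u : ℂ => u ^ k * h u) 0 := by fun_prop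
    simpa [ContinuousAt, zero_pow (by omega : k ≠ 0)] using this
  refine ⟨(‖h 0‖ + K) ^ 2 + K, by positivity, ?_⟩
  filter_upwards [hd, hK.bound, hx0.eventually (Metric.ball_mem_nhds 0 (show (0 : ℝ) < 1 / 2 by norm_num)),
    Metric.ball_mem_nhds (0 : ℂ) one_pos] with u hu hKu hxu hu1
  replace hxu : ‖u ^ k * h u‖ < 1 / 2 := mem_ball_zero_iff.1 hxu
  rw [mem_ball_zero_iff] at hu1
  rw [sub_zero] at hKu
  have hhu : ‖h u‖ ≤ ‖h 0‖ + K := by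
    have h1 := norm_add_le (h u - h 0) (h 0)
    rw [sub_add_cancel] at h1
    nlinarith
  have hslit : 1 + u ^ k * h u ∈ Complex.slitPlane :=
    Complex.mem_slitPlane_of_norm_lt_one (by linarith)
  refine ⟨?_, ?_, Complex.exp_log (Complex.slitPlane_ne_zero hslit)⟩
  · exact DifferentiableAt.clog (by fun_prop) hslit
  · have e : Complex.log (1 + u ^ k * h u) - h 0 * u ^ k
        = (Complex.log (1 + u ^ k * h u) - u ^ k * h u) + u ^ k * (h u - h 0) := by ring
    have h1 : ‖Complex.log (1 + u ^ k * h u) - u ^ k * h u‖ ≤ ‖u ^ k * h u‖ ^ 2 := by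
      refine (Complex.norm_log_one_add_sub_self_le (by linarith)).trans ?_
      have : (1 - ‖u ^ k * h u‖)⁻¹ ≤ 2 := by
        rw [inv_le_comm₀ (by linarith) (by norm_num)]
        linarith
      have := mul_le_mul_of_nonneg_left this (sq_nonneg ‖u ^ k * h u‖)
      linarith
    have h2 : ‖u ^ k * h u‖ ^ 2 ≤ (‖h 0‖ + K) ^ 2 * ‖u‖ ^ (k + 1) := by
      rw [norm_mul, norm_pow, mul_pow, ← pow_mul, mul_comm]
      have := pow_le_pow_of_le_one (norm_nonneg u) hu1.le (show k + 1 ≤ k * 2 by omega)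
      gcongr
    have h3 : ‖u ^ k * (h u - h 0)‖ ≤ K * ‖u‖ ^ (k + 1) := by
      rw [norm_mul, norm_pow, pow_succ, mul_comm, ← mul_assoc, mul_right_comm]
      exact mul_le_mul_of_nonneg_right hKu (by positivity)
    rw [e]
    refine (norm_add_le _ _).trans ?_
    linarith

theorem continuous_monomialPow {n : ℕ} (α : Fin n → ℕ) :
    Continuous (fun z : Fin n → ℂ => monomialPow z α) := by
  unfold monomialPow
  fun_prop

theorem monomialPow_zero {n : ℕ} {α : Fin n → ℕ} (hα : α ≠ 0) :
    monomialPow (0 : Fin n → ℂ) α = 0 := by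
  obtain ⟨i, hi⟩ := Function.ne_iff.1 hα
  exact Finset.prod_eq_zero (Finset.mem_univ i) (by simpa using hi)

theorem exists_logMultipliers {n : ℕ} {lam : Fin n → ℂ} {α : Fin n → ℕ} {a : Fin n → ℕ → ℂ}
    {k₀ : ℕ} (hlam : ∀ j, lam j ≠ 0) (hα : α ≠ 0) (hk₀ : IsWeightedOrder a k₀)
    {F : (Fin n → ℂ) → Fin n → ℂ}
    (hF : ∀ᶠ z in 𝓝 (0 : Fin n → ℂ), ∀ j,
      HasSum (fun k : ℕ => a j (k + 1) * monomialPow z α ^ (k + 1) * z j) (F z j - lam j * z j)) :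
    ∃ L ρ C, LogMultipliers (fun j => a j k₀ / lam j) L k₀ ρ C ∧
      ∀ᶠ z in 𝓝 (0 : Fin n → ℂ), ∀ j, F z j = lam j * z j * Complex.exp (L j (monomialPow z α)) := by
  obtain ⟨k, rfl⟩ : ∃ k, k₀ = k + 1 := ⟨k₀ - 1, by have := hk₀.1.1; omega⟩
  obtain ⟨T, hT0, hT⟩ : ∃ T : ℝ, 0 < T ∧ ∀ j, Summable (fun i : ℕ => a j (i + 1) * (T : ℂ) ^ (i + 1)) := by
    have hcont : Continuous (fun t : ℝ => (fun _ : Fin n => (t : ℂ))) := by fun_prop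
    have h1 : Tendsto (fun t : ℝ => (fun _ : Fin n => (t : ℂ))) (𝓝 0) (𝓝 0) := by
      have := hcont.tendsto 0
      rwa [show (fun _ : Fin n => ((0 : ℝ) : ℂ)) = 0 by ext; simp] at this
    have h2 : ∀ᶠ t : ℝ in 𝓝[>] 0, 0 < t := self_mem_nhdsWithin
    obtain ⟨t, ht, ht0⟩ := (((h1.mono_left nhdsWithin_le_nhds).eventually hF).and h2).exists
    refine ⟨∏ i, t ^ α i, by positivity, fun j => ?_⟩
    have := (ht j).summable
    have ht' : (t : ℂ) ≠ 0 := by exact_mod_cast ht0.ne'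
    rw [summable_mul_right_iff ht'] at this
    simpa [monomialPow] using this
  set h : Fin n → ℂ → ℂ := fun j u => ∑' i : ℕ, a j (i + k + 1) / lam j * u ^ i with hh
  have hbound : ∀ j, ∃ M : ℝ, ∀ (i : ℕ), ∀ u ∈ Metric.ball (0 : ℂ) (T / 2),
      ‖a j (i + k + 1) / lam j * u ^ i‖ ≤ M * (1 / 2 : ℝ) ^ i := by
    intro j
    obtain ⟨M, hM⟩ := (hT j).tendsto_atTop_zero.norm.bddAbove_range
    refine ⟨M / ‖lam j‖ / T ^ (k + 1), fun i u hu => ?_⟩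
    rw [mem_ball_zero_iff] at hu
    have h1 : ‖a j (i + k + 1)‖ * T ^ (i + k + 1) ≤ M := by
      have := hM (mem_range_self (i + k))
      simpa [abs_of_pos hT0] using this
    have h2 : ‖u‖ ^ i ≤ (T / 2) ^ i := pow_le_pow_left₀ (norm_nonneg _) hu.le i
    have hl : 0 < ‖lam j‖ := norm_pos_iff.2 (hlam j)
    have h3 : ‖a j (i + k + 1)‖ ≤ M / T ^ (i + k + 1) := (le_div_iff₀ (by positivity)).2 h1
    rw [norm_mul, norm_div, norm_pow]
    calc ‖a j (i + k + 1)‖ / ‖lam j‖ * ‖u‖ ^ i ≤ M / T ^ (i + k + 1) / ‖lam j‖ * (T / 2) ^ i := by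
          gcongr
          exact div_nonneg ((norm_nonneg _).trans h3) hl.le
      _ = M / ‖lam j‖ / T ^ (k + 1) * (1 / 2 : ℝ) ^ i := by
          rw [div_pow, div_pow, show i + k + 1 = i + (k + 1) by ring, pow_add T i]
          field_simp
          simp
  have hgeo : Summable (fun i : ℕ => (1 / 2 : ℝ) ^ i) := summable_geometric_two
  have hsummable : ∀ j, ∀ u ∈ Metric.ball (0 : ℂ) (T / 2),
      Summable (fun i : ℕ => a j (i + k + 1) / lam j * u ^ i) := by
    intro j u hu
    obtain ⟨M, hM⟩ := hbound j
    exact Summable.of_norm_bounded (hgeo.mul_left M) (fun i => hM i u hu)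
  have hdiff : ∀ j, ∀ᶠ u in 𝓝 (0 : ℂ), DifferentiableAt ℂ (h j) u := by
    intro j
    obtain ⟨M, hM⟩ := hbound j
    have := Complex.differentiableOn_tsum_of_summable_norm (hgeo.mul_left M)
      (F := fun (i : ℕ) u => a j (i + k + 1) / lam j * u ^ i) (fun i => by fun_prop)
      (Metric.isOpen_ball (x := (0 : ℂ)) (ε := T / 2)) hM
    filter_upwards [Metric.isOpen_ball.mem_nhds (Metric.mem_ball_self (half_pos hT0))] with u hu
    exact this.differentiableAt (Metric.isOpen_ball.mem_nhds hu)
  have hsum : ∀ j, ∀ u ∈ Metric.ball (0 : ℂ) (T / 2),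
      HasSum (fun i : ℕ => a j (i + 1) * u ^ (i + 1)) (lam j * (u ^ (k + 1) * h j u)) := by
    intro j u hu
    rw [← hasSum_nat_add_iff' k, Finset.sum_eq_zero, sub_zero]
    · have := ((hsummable j u hu).hasSum.mul_left (u ^ (k + 1))).mul_left (lam j)
      have e : (fun i : ℕ => a j (i + k + 1) * u ^ (i + k + 1))
          = fun i => lam j * (u ^ (k + 1) * (a j (i + k + 1) / lam j * u ^ i)) := by
        funext i
        have := hlam j
        field_simp
        ring
      rw [e]
      exact this
    · intro i hi
      have : a j (i + 1) = 0 := by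
        by_contra hne
        have := hk₀.2 ⟨by omega, j, hne⟩
        have := Finset.mem_range.1 hi
        omega
      rw [this, zero_mul]
  have hzero : ∀ j, h j 0 = a j (k + 1) / lam j := by
    intro j
    rw [hh]
    dsimp only
    rw [tsum_eq_single 0 (fun i hi => by simp [hi])]
    simp
  choose C hC0 hC using fun j => log_one_add_pow_mul (hdiff j) (show 1 ≤ k + 1 by omega)
  obtain ⟨ρ, hρ0, hρ⟩ := Metric.eventually_nhds_iff_ball.1 (eventually_all.2 hC)
  refine ⟨fun j u => Complex.log (1 + u ^ (k + 1) * h j u), ρ, ∑ j, C j,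
    ⟨by omega, hρ0, Finset.sum_nonneg fun j _ => hC0 j, ?_, ?_⟩, ?_⟩
  · exact fun j u hu => (hρ u hu j).1.differentiableWithinAt
  · intro j u hu
    have := (hρ u hu j).2.1
    rw [hzero] at this
    refine this.trans (mul_le_mul_of_nonneg_right ?_ (by positivity))
    exact Finset.single_le_sum (fun j _ => hC0 j) (Finset.mem_univ j)
  · have hu0 : Tendsto (fun z : Fin n → ℂ => monomialPow z α) (𝓝 0) (𝓝 0) := by
      have := (continuous_monomialPow α).tendsto 0
      rwa [monomialPow_zero hα] at this
    filter_upwards [hF, hu0.eventually (Metric.ball_mem_nhds 0 hρ0),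
      hu0.eventually (Metric.ball_mem_nhds 0 (half_pos hT0))] with z hz hz1 hz2
    intro j
    have := (hz j).unique ((hsum j _ hz2).mul_right (z j))
    rw [(hρ _ hz1 j).2.2]
    linear_combination this

theorem monomialPow_ne_zero {n : ℕ} {z : Fin n → ℂ} {α : Fin n → ℕ} {j : Fin n}
    (h : monomialPow z α ≠ 0) (hj : α j ≠ 0) : z j ≠ 0 := by
  intro h0
  exact h (Finset.prod_eq_zero (Finset.mem_univ j) (by rw [h0, zero_pow hj]))

theorem monomialPow_mul {n : ℕ} (z w : Fin n → ℂ) (α : Fin n → ℕ) :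
    monomialPow (fun j => z j * w j) α = monomialPow z α * monomialPow w α := by
  simp only [monomialPow, mul_pow, Finset.prod_mul_distrib]

theorem monomialPow_exp {n : ℕ} (w : Fin n → ℂ) (α : Fin n → ℕ) :
    monomialPow (fun j => Complex.exp (w j)) α = Complex.exp (∑ j, α j * w j) := by
  simp only [monomialPow, Complex.exp_sum, ← Complex.exp_nat_mul]

theorem tendsto_div_pow {g : ℂ → ℂ} {a : ℂ} {C ρ : ℝ} {k : ℕ} (hρ : 0 < ρ)
    (hb : ∀ u ∈ Metric.ball (0 : ℂ) ρ, ‖g u - a * u ^ k‖ ≤ C * ‖u‖ ^ (k + 1)) :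
    Tendsto (fun u => g u / u ^ k) (𝓝[≠] 0) (𝓝 a) := by
  rw [tendsto_iff_norm_sub_tendsto_zero]
  have h0 : Tendsto (fun u : ℂ => C * ‖u‖) (𝓝[≠] 0) (𝓝 0) := by
    have : Continuous (fun u : ℂ => C * ‖u‖) := by fun_prop
    simpa using (this.tendsto 0).mono_left nhdsWithin_le_nhds
  refine squeeze_zero' (Eventually.of_forall fun _ => norm_nonneg _) ?_ h0
  filter_upwards [nhdsWithin_le_nhds (Metric.ball_mem_nhds (0 : ℂ) hρ), self_mem_nhdsWithin]
    with u hu hu0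
  have hu0' : u ≠ 0 := hu0
  have e : g u / u ^ k - a = (g u - a * u ^ k) / u ^ k := by field_simp
  rw [e, norm_div, norm_pow, div_le_iff₀ (by positivity)]
  refine (hb u hu).trans (le_of_eq ?_)
  ring

theorem LogMultipliers.apply_zero {ι : Type*} {A : ι → ℂ} {L : ι → ℂ → ℂ} {k : ℕ} {ρ C : ℝ}
    (h : LogMultipliers A L k ρ C) (j : ι) : L j 0 = 0 := by
  have := h.bound j 0 (Metric.mem_ball_self h.rho_pos)
  have hk : k ≠ 0 := by have := h.one_le; omega
  simpa [zero_pow hk] using this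

theorem LogMultipliers.tendsto_zero {ι : Type*} {A : ι → ℂ} {L : ι → ℂ → ℂ} {k : ℕ} {ρ C : ℝ}
    (h : LogMultipliers A L k ρ C) (j : ι) : Tendsto (L j) (𝓝 0) (𝓝 0) := by
  have := ((h.differentiableOn j).differentiableAt (Metric.ball_mem_nhds 0 h.rho_pos)).continuousAt
  rwa [ContinuousAt, h.apply_zero] at this

/-- A coordinate that is repelling along the attracting directions of the resonant monomial
prevents nontrivial orbits from converging to the origin. -/
theorem eq_zero_of_tendsto_zero {n : ℕ} {lam : Fin n → ℂ} {α : Fin n → ℕ} {A : Fin n → ℂ}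
    {L : Fin n → ℂ → ℂ} {k : ℕ} {ρ C : ℝ} (hL : LogMultipliers A L k ρ C)
    (hmod : ∀ j, ‖lam j‖ = 1) (hlam : monomialPow lam α = 1) {Λ : ℂ} (hΛ : Λ = ∑ j, α j * A j)
    (hΛ0 : Λ ≠ 0) {h : Fin n} (hαh : α h ≠ 0) (hAh : (A h / Λ).re < 0) {z : ℕ → Fin n → ℂ}
    (hz : ∀ l j, z (l + 1) j = lam j * z l j * Complex.exp (L j (monomialPow (z l) α)))
    (hlim : Tendsto z atTop (𝓝 0)) : z 0 = 0 := by
  have hα : α ≠ 0 := fun h0 => hαh (by rw [h0]; rfl)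
  set u : ℕ → ℂ := fun l => monomialPow (z l) α with hu
  set S : ℂ → ℂ := fun v => ∑ j, α j * L j v with hS
  have hulim : Tendsto u atTop (𝓝 0) := by
    have := ((continuous_monomialPow α).tendsto 0).comp hlim
    rwa [monomialPow_zero hα] at this
  have hustep : ∀ l, u (l + 1) = u l * Complex.exp (S (u l)) := by
    intro l
    have : z (l + 1) = fun j => (lam j * z l j) * Complex.exp (L j (u l)) := funext fun j => hz l j
    simp only [hu]
    rw [this, monomialPow_mul, monomialPow_mul, monomialPow_exp, hlam, one_mul]
  have hnorm : ∀ l j, ‖z (l + 1) j‖ = ‖z l j‖ * Real.exp (L j (u l)).re := by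
    intro l j
    rw [hz, norm_mul, norm_mul, hmod, one_mul, Complex.norm_exp]
  have hlimj : ∀ j, Tendsto (fun l => ‖z l j‖) atTop (𝓝 0) := by
    intro j
    have := ((continuous_apply j).norm.tendsto (0 : Fin n → ℂ)).comp hlim
    rw [Pi.zero_apply, norm_zero] at this
    exact this
  by_cases hu0 : u 0 = 0
  · have hul : ∀ l, u l = 0 := by
      intro l
      induction l with
      | zero => exact hu0
      | succ l ih => rw [hustep, ih, zero_mul]
    ext j
    have hc : ∀ l, ‖z l j‖ = ‖z 0 j‖ := by
      intro l
      induction l with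
      | zero => rfl
      | succ l ih => rw [hnorm, hul, hL.apply_zero, Complex.zero_re, Real.exp_zero, mul_one, ih]
    have := hlimj j
    simp only [hc] at this
    simpa using tendsto_nhds_unique tendsto_const_nhds this
  exfalso
  have hul : ∀ l, u l ≠ 0 := by
    intro l
    induction l with
    | zero => exact hu0
    | succ l ih =>
      rw [hustep]
      exact mul_ne_zero ih (Complex.exp_ne_zero _)
  have hk := hL.one_le
  have hkC : (k : ℂ) ≠ 0 := by
    have : k ≠ 0 := by omega
    exact_mod_cast this
  have hulim' : Tendsto u atTop (𝓝[≠] 0) :=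
    tendsto_nhdsWithin_iff.2 ⟨hulim, Eventually.of_forall hul⟩
  set y : ℕ → ℂ := fun l => -1 / (k * Λ * u l ^ k) with hy
  have hS0 : Tendsto S (𝓝 0) (𝓝 0) := by
    have : Tendsto S (𝓝 0) (𝓝 (∑ j, (α j : ℂ) * 0)) :=
      tendsto_finsetSum _ fun j _ => (hL.tendsto_zero j).const_mul _
    simpa using this
  have hSk : Tendsto (fun v => S v / v ^ k) (𝓝[≠] 0) (𝓝 Λ) := by
    refine tendsto_div_pow hL.rho_pos (C := (∑ j, (α j : ℝ)) * C) fun v hv => ?_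
    rw [hΛ]
    exact norm_sum_sub_le hL α hv
  have hstep : Tendsto (fun l => y (l + 1) - y l) atTop (𝓝 1) := by
    have hq : ContinuousAt (dslope Complex.exp 0) 0 :=
      continuousAt_dslope_same.2 Complex.differentiableAt_exp
    have hq1 : dslope Complex.exp 0 0 = 1 := by
      rw [dslope_same, Complex.deriv_exp, Complex.exp_zero]
    have h1 : Tendsto (fun l => -k * S (u l)) atTop (𝓝 0) := by
      simpa using (hS0.comp hulim).const_mul (-k : ℂ)
    have h2 := hq.tendsto.comp h1
    rw [hq1] at h2
    have h3 := ((hSk.comp hulim').div_const Λ).mul h2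
    rw [div_self hΛ0, one_mul] at h3
    refine h3.congr fun l => ?_
    have h4 := sub_smul_dslope Complex.exp 0 (-k * S (u l))
    rw [sub_zero, smul_eq_mul, Complex.exp_zero] at h4
    have h5 : Complex.exp (-k * S (u l)) * Complex.exp (S (u l)) ^ k = 1 := by
      rw [← Complex.exp_nat_mul, ← Complex.exp_add]
      simp
    have h6 : y (l + 1) = y l * Complex.exp (-k * S (u l)) := by
      simp only [hy]
      rw [hustep, mul_pow]
      have := hul l
      have := Complex.exp_ne_zero (S (u l))
      rw [eq_inv_of_mul_eq_one_left h5]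
      field_simp
    have h7 : y (l + 1) - y l = y l * (-k * S (u l) * dslope Complex.exp 0 (-k * S (u l))) := by
      rw [h4, h6]
      ring
    rw [h7]
    simp only [Function.comp_apply, hy]
    have := hul l
    field_simp
  have hyN : Tendsto (fun N : ℕ => ((N : ℂ))⁻¹ * y N) atTop (𝓝 1) := by
    have h1 := hstep.cesaro_smul
    have h2 : Tendsto (fun N : ℕ => ((N : ℂ))⁻¹ * y 0) atTop (𝓝 0) := by
      simpa using (tendsto_inv_atTop_nhds_zero_nat (𝕜 := ℂ)).mul_const (y 0)
    have h3 := h1.add h2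
    rw [add_zero] at h3
    refine h3.congr fun N => ?_
    rw [Finset.sum_range_sub, Complex.real_smul]
    push_cast
    ring
  have hLk : Tendsto (fun v => L h v / v ^ k) (𝓝[≠] 0) (𝓝 (A h)) :=
    tendsto_div_pow hL.rho_pos (hL.bound h)
  have hLN : Tendsto (fun N : ℕ => (N : ℂ) * L h (u N)) atTop (𝓝 (-(A h / Λ) / k)) := by
    have h1 := ((hLk.comp hulim').mul_const (-1 / (k * Λ))).div hyN one_ne_zero
    have e : A h * (-1 / (k * Λ)) / 1 = -(A h / Λ) / k := by
      field_simp
    rw [e] at h1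
    refine h1.congr' ?_
    filter_upwards [eventually_gt_atTop 0] with N hN
    have hN' : (N : ℂ) ≠ 0 := by exact_mod_cast hN.ne'
    have := hul N
    simp only [Function.comp_apply, hy, Pi.div_apply]
    field_simp
  have hre : ∀ᶠ N : ℕ in atTop, 0 ≤ (L h (u N)).re := by
    have h1 := (Complex.continuous_re.tendsto _).comp hLN
    have h2 : 0 < (-(A h / Λ) / k).re := by
      rw [show (k : ℂ) = ((k : ℝ) : ℂ) by simp, Complex.div_ofReal_re, Complex.neg_re]
      have : (0 : ℝ) < k := by exact_mod_cast hk
      exact div_pos (by linarith) this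
    filter_upwards [h1.eventually (lt_mem_nhds h2)] with N hN
    have h3 : 0 < (N : ℝ) * (L h (u N)).re := by simpa using hN
    exact (pos_of_mul_pos_right h3 (by positivity)).le
  obtain ⟨N, hN⟩ := eventually_atTop.1 hre
  have hmono : ∀ l, N ≤ l → ‖z N h‖ ≤ ‖z l h‖ := by
    intro l hl
    induction l, hl using Nat.le_induction with
    | base => exact le_rfl
    | succ l hl ih =>
      rw [hnorm]
      refine ih.trans (le_mul_of_one_le_right (norm_nonneg _) (Real.one_le_exp (hN l hl)))
  have h1 : ‖z N h‖ ≤ 0 := ge_of_tendsto (hlimj h) (eventually_atTop.2 ⟨N, hmono⟩)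
  exact monomialPow_ne_zero (hul N) hαh (norm_le_zero_iff.1 h1)

/-- On the ball of radius `r`, the chart `Φ` conjugates `G` to the normal form with logarithmic
multipliers `L`. -/
structure IsNormalChart {n : ℕ} (G Φ : OpenPartialHomeomorph (Fin n → ℂ) (Fin n → ℂ))
    (lam : Fin n → ℂ) (α : Fin n → ℕ) (L : Fin n → ℂ → ℂ) (r : ℝ) : Prop where
  r_pos : 0 < r
  mem_target : ∀ z ∈ Metric.ball 0 r, z ∈ Φ.target
  mem_source : ∀ z ∈ Metric.ball 0 r, Φ.symm z ∈ G.source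
  map_mem_source : ∀ z ∈ Metric.ball 0 r, G (Φ.symm z) ∈ Φ.source
  conj : ∀ z ∈ Metric.ball 0 r, ∀ j,
    Φ (G (Φ.symm z)) j = lam j * z j * Complex.exp (L j (monomialPow z α))

theorem IsBiholomorphicGerm.symm_zero {n : ℕ}
    {Φ : OpenPartialHomeomorph (Fin n → ℂ) (Fin n → ℂ)} (hΦ : IsBiholomorphicGerm Φ) :
    (0 : Fin n → ℂ) ∈ Φ.target ∧ Φ.symm 0 = 0 := by
  have h1 := Φ.map_source hΦ.zero_mem_source
  have h2 := Φ.left_inv hΦ.zero_mem_source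
  rw [hΦ.map_zero] at h1 h2
  exact ⟨h1, h2⟩

theorem exists_isNormalChart {n : ℕ} {G Φ : OpenPartialHomeomorph (Fin n → ℂ) (Fin n → ℂ)}
    (hG : IsBiholomorphicGerm G) (hΦ : IsBiholomorphicGerm Φ) {lam : Fin n → ℂ} {α : Fin n → ℕ}
    {L : Fin n → ℂ → ℂ}
    (h : ∀ᶠ z in 𝓝 (0 : Fin n → ℂ), ∀ j,
      Φ (G (Φ.symm z)) j = lam j * z j * Complex.exp (L j (monomialPow z α))) :
    ∃ r, IsNormalChart G Φ lam α L r := by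
  obtain ⟨h0, h0'⟩ := hΦ.symm_zero
  have c1 : ContinuousAt Φ.symm 0 := Φ.continuousAt_symm h0
  have c2 : ContinuousAt G (Φ.symm 0) := by
    rw [h0']
    exact G.continuousAt hG.zero_mem_source
  have e1 : ∀ᶠ z in 𝓝 (0 : Fin n → ℂ), z ∈ Φ.target := Φ.open_target.mem_nhds h0
  have e2 : ∀ᶠ z in 𝓝 (0 : Fin n → ℂ), Φ.symm z ∈ G.source :=
    c1.eventually_mem (G.open_source.mem_nhds (by rw [h0']; exact hG.zero_mem_source))
  have e3 : ∀ᶠ z in 𝓝 (0 : Fin n → ℂ), G (Φ.symm z) ∈ Φ.source :=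
    (c2.comp c1).eventually_mem (Φ.open_source.mem_nhds (by
      rw [Function.comp_apply, h0', hG.map_zero]
      exact hΦ.zero_mem_source))
  obtain ⟨r, hr, hr'⟩ := Metric.eventually_nhds_iff_ball.1 (e1.and (e2.and (e3.and h)))
  exact ⟨r, hr, fun z hz => (hr' z hz).1, fun z hz => (hr' z hz).2.1,
    fun z hz => (hr' z hz).2.2.1, fun z hz => (hr' z hz).2.2.2⟩

theorem eq_zero_of_iterate_eq_zero {n : ℕ} {G : OpenPartialHomeomorph (Fin n → ℂ) (Fin n → ℂ)}
    (hG : IsBiholomorphicGerm G) {w : Fin n → ℂ} (hw : ∀ l : ℕ, G^[l] w ∈ G.source) {l : ℕ}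
    (h : G^[l] w = 0) : w = 0 := by
  induction l with
  | zero => exact h
  | succ l ih =>
    rw [Function.iterate_succ_apply'] at h
    exact ih (G.injOn (hw l) hG.zero_mem_source (h.trans hG.map_zero.symm))

theorem orbitConvergesToOrigin_iff {n : ℕ} {G Φ : OpenPartialHomeomorph (Fin n → ℂ) (Fin n → ℂ)}
    (hG : IsBiholomorphicGerm G) (hΦ : IsBiholomorphicGerm Φ) {lam : Fin n → ℂ} {α : Fin n → ℕ}
    {A : Fin n → ℂ} {L : Fin n → ℂ → ℂ} {k : ℕ} {ρ C r : ℝ} (hL : LogMultipliers A L k ρ C)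
    (hchart : IsNormalChart G Φ lam α L r)
    (hmod : ∀ j, ‖lam j‖ = 1) (hlam : monomialPow lam α = 1) {Λ : ℂ} (hΛ : Λ = ∑ j, α j * A j)
    (hΛ0 : Λ ≠ 0) {h : Fin n} (hαh : α h ≠ 0) (hAh : (A h / Λ).re < 0) (w : Fin n → ℂ) :
    OrbitConvergesToOrigin G w ↔ w = 0 := by
  constructor
  · rintro ⟨hs, hlim⟩
    have hΦ0 : Tendsto (fun l : ℕ => Φ (G^[l] w)) atTop (𝓝 0) := by
      have := (Φ.continuousAt hΦ.zero_mem_source).tendsto.comp hlim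
      rwa [hΦ.map_zero] at this
    obtain ⟨N, hN⟩ := eventually_atTop.1
      ((hlim.eventually_mem (Φ.open_source.mem_nhds hΦ.zero_mem_source)).and
        (hΦ0.eventually_mem (Metric.ball_mem_nhds 0 hchart.r_pos)))
    have h0 : Φ (G^[0 + N] w) = 0 := by
      refine eq_zero_of_tendsto_zero (z := fun l => Φ (G^[l + N] w)) hL hmod hlam hΛ hΛ0 hαh hAh
        (fun l j => ?_) (hΦ0.comp (tendsto_add_atTop_nat N))
      obtain ⟨h1, h2⟩ := hN (l + N) (by omega)
      have := hchart.conj _ h2 j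
      rw [Φ.left_inv h1, ← Function.iterate_succ_apply' G] at this
      rw [show l + 1 + N = (l + N).succ by omega]
      exact this
    rw [zero_add] at h0
    have h1 := Φ.injOn (hN N le_rfl).1 hΦ.zero_mem_source (h0.trans hΦ.map_zero.symm)
    exact eq_zero_of_iterate_eq_zero hG hs h1
  · rintro rfl
    have : ∀ l : ℕ, G^[l] 0 = 0 := fun l => Function.iterate_fixed hG.map_zero l
    refine ⟨fun l => ?_, ?_⟩
    · rw [this]
      exact hG.zero_mem_source
    · simp only [this]
      exact tendsto_const_nhds

theorem monomialPow_add {n : ℕ} (z : Fin n → ℂ) (L L' : Fin n → ℕ) :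
    monomialPow z (L + L') = monomialPow z L * monomialPow z L' := by
  simp only [monomialPow, Pi.add_apply, pow_add, Finset.prod_mul_distrib]

theorem monomialPow_smul {n : ℕ} (z : Fin n → ℂ) (i : ℕ) (L : Fin n → ℕ) :
    monomialPow z (i • L) = monomialPow z L ^ i := by
  simp only [monomialPow, Pi.smul_apply, smul_eq_mul, ← Finset.prod_pow, ← pow_mul, mul_comm i]

theorem monomialPow_pow {n : ℕ} (z : Fin n → ℂ) (i : ℕ) (L : Fin n → ℕ) :
    monomialPow (fun j => z j ^ i) L = monomialPow z L ^ i := by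
  simp only [monomialPow, ← Finset.prod_pow, ← pow_mul, mul_comm i]

theorem monomialPow_single {n : ℕ} (z : Fin n → ℂ) (j : Fin n) :
    monomialPow z (Pi.single j 1) = z j := by
  rw [monomialPow, Finset.prod_eq_single j]
  · simp
  · intro i _ hi
    simp [hi]
  · simp

section Resonance

variable {n : ℕ} {G : OpenPartialHomeomorph (Fin n → ℂ) (Fin n → ℂ)} {lam : Fin n → ℂ}
  {α : Fin n → ℕ}

theorem IsOneResonant.monomialPow_generator (h : IsOneResonant G lam α) (hlam : ∀ j, lam j ≠ 0) :
    monomialPow lam α = 1 := by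
  obtain ⟨j, -⟩ := Function.ne_iff.1 h.generator_ne_zero
  have hmem : Pi.single j 1 + 1 • α ∈ resonances lam j := by
    rw [h.resonances_eq]
    exact ⟨1, le_rfl, rfl⟩
  have h2 := hmem.2
  rw [one_smul, monomialPow_add, monomialPow_single] at h2
  exact mul_left_cancel₀ (hlam j) (h2.trans (mul_one _).symm)

theorem IsOneResonant.monomialPow_ne_one (h : IsOneResonant G lam α) {d : ℕ} {β : Fin n → ℕ}
    (hβ : α = d • β) {i : ℕ} (hi : 1 ≤ i) (hid : i < d) : monomialPow lam β ^ i ≠ 1 := by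
  intro h1
  obtain ⟨j, hj⟩ := Function.ne_iff.1 h.generator_ne_zero
  have hβj : β j ≠ 0 := by
    intro h0
    apply hj
    rw [hβ, Pi.smul_apply, h0, smul_zero, Pi.zero_apply]
  have hmem : Pi.single j 1 + i • β ∈ resonances lam j := by
    constructor
    · rw [← Finset.add_sum_erase _ _ (Finset.mem_univ j)]
      have : 1 ≤ i * β j := Nat.mul_pos hi (Nat.pos_of_ne_zero hβj)
      simp only [Pi.add_apply, Pi.single_eq_same, Pi.smul_apply, smul_eq_mul]
      omega
    · rw [monomialPow_add, monomialPow_single, monomialPow_smul, h1, mul_one]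
  rw [h.resonances_eq] at hmem
  obtain ⟨k, hk, hk'⟩ := hmem
  have h2 := congrFun (add_left_cancel hk') j
  rw [hβ] at h2
  simp only [Pi.smul_apply, smul_eq_mul, ← mul_assoc] at h2
  have h3 : i = k * d := Nat.eq_of_mul_eq_mul_right (Nat.pos_of_ne_zero hβj) h2
  have : d ≤ k * d := Nat.le_mul_of_pos_left d hk
  omega

end Resonance

theorem exists_bezout {ι : Type*} [Fintype ι] (α : ι → ℕ) :
    ∃ b : ι → ℤ, ∑ j, (α j : ℤ) * b j = (Finset.univ.gcd α : ℕ) := by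
  obtain ⟨g, hg⟩ := Finset.gcd_eq_sum_mul Finset.univ (fun j => (α j : ℤ))
  refine ⟨g, hg.symm.trans ?_⟩
  have h1 : 0 ≤ Finset.univ.gcd (fun j => (α j : ℤ)) := by
    rw [← Finset.normalize_gcd]
    exact Int.nonneg_of_normalize_eq_self (normalize_idem _)
  lift Finset.univ.gcd (fun j => (α j : ℤ)) to ℕ using h1 with e he
  congr 1
  apply Nat.dvd_antisymm
  · refine Finset.dvd_gcd fun j hj => ?_
    rw [← Int.natCast_dvd_natCast, he]
    exact Finset.gcd_dvd hj
  · rw [← Int.natCast_dvd_natCast, he]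
    exact Finset.dvd_gcd fun j hj => Int.natCast_dvd_natCast.2 (Finset.gcd_dvd hj)

/-- Multipliers of modulus one with `lam ^ α = 1` split as `lam_j = ζ_j exp (i θ_j)`, where the
`ζ_j` are `d`-th roots of unity and the angles satisfy the resonance relation exactly. -/
theorem exists_roots_of_unity {s : ℕ} {lam : Fin s → ℂ} {α : Fin s → ℕ} (hα : α ≠ 0)
    (hmod : ∀ j, ‖lam j‖ = 1) (hlam : monomialPow lam α = 1) :
    ∃ (θ : Fin s → ℝ) (ζ : Fin s → ℂ), ∑ j, α j * θ j = 0 ∧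
      (∀ j, lam j = ζ j * Complex.exp (Complex.I * θ j)) ∧ ∀ j, ζ j ^ Finset.univ.gcd α = 1 := by
  set d := Finset.univ.gcd α with hd
  have hd0 : d ≠ 0 := by
    rw [hd, Ne, Finset.gcd_eq_zero_iff]
    intro h
    exact hα (funext fun j => h j (Finset.mem_univ j))
  obtain ⟨b, hb⟩ := exists_bezout α
  rw [← hd] at hb
  set η : Fin s → ℝ := fun j => (lam j).arg with hη
  have hlamη : ∀ j, lam j = Complex.exp (Complex.I * η j) := by
    intro j
    have := Complex.norm_mul_exp_arg_mul_I (lam j)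
    rw [hmod, Complex.ofReal_one, one_mul] at this
    rw [← this, mul_comm]
  obtain ⟨p, hp⟩ : ∃ p : ℤ, ∑ j, α j * η j = 2 * Real.pi * p := by
    have h1 : Complex.exp (∑ j, α j * (Complex.I * η j)) = 1 := by
      rw [← monomialPow_exp, ← hlam]
      congr 1
      exact funext fun j => (hlamη j).symm
    obtain ⟨p, hp⟩ := Complex.exp_eq_one_iff.1 h1
    refine ⟨p, ?_⟩
    have e : ∑ j, (α j : ℂ) * (Complex.I * η j) = Complex.I * ∑ j, (α j : ℂ) * η j := by
      rw [Finset.mul_sum]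
      exact Finset.sum_congr rfl fun j _ => by ring
    rw [e] at hp
    have h2 : ∑ j, (α j : ℂ) * η j = 2 * Real.pi * p := by
      have := Complex.I_ne_zero
      apply mul_left_cancel₀ this
      rw [hp]
      ring
    exact_mod_cast h2
  have hbR : ∑ j, (α j : ℝ) * b j = d := by exact_mod_cast hb
  have hdR : (d : ℝ) ≠ 0 := by exact_mod_cast hd0
  have hdC : (d : ℂ) ≠ 0 := by exact_mod_cast hd0
  set θ : Fin s → ℝ := fun j => η j - 2 * Real.pi * p / d * b j with hθ
  refine ⟨θ, fun j => Complex.exp (b j * p * (2 * Real.pi * Complex.I) / d), ?_, fun j => ?_,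
    fun j => ?_⟩
  · have e : ∀ j, (α j : ℝ) * θ j = α j * η j - 2 * Real.pi * p / d * (α j * b j) := fun j => by
      rw [hθ]
      ring
    rw [Finset.sum_congr rfl fun j _ => e j, Finset.sum_sub_distrib, ← Finset.mul_sum, hp, hbR]
    field_simp
    ring
  · rw [hlamη, ← Complex.exp_add, hθ]
    congr 1
    push_cast
    ring
  · rw [← Complex.exp_nat_mul, Complex.exp_eq_one_iff]
    refine ⟨b j * p, ?_⟩
    push_cast
    field_simp

/-- The closed embedding of `ℂˢ` into `ℂⁿ` as the first `s` coordinates. -/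
def firstCoords {s n : ℕ} (x : Fin s → ℂ) (j : Fin n) : ℂ :=
  if h : (j : ℕ) < s then x ⟨j, h⟩ else 0

section FirstCoords

variable {s n : ℕ}

theorem firstCoords_castLE (h : s ≤ n) (x : Fin s → ℂ) (j : Fin s) :
    firstCoords x (Fin.castLE h j) = x j := by
  simp [firstCoords]

theorem contDiff_firstCoords : ContDiff ℂ 1 (firstCoords : (Fin s → ℂ) → Fin n → ℂ) := by
  refine contDiff_pi.2 fun j => ?_
  by_cases h : (j : ℕ) < s
  · simp only [firstCoords, h, dite_true]
    exact contDiff_apply ℂ ℂ _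
  · simp only [firstCoords, h, dite_false]
    exact contDiff_const

theorem firstCoords_zero : (firstCoords (0 : Fin s → ℂ) : Fin n → ℂ) = 0 := by
  ext j
  simp [firstCoords]

theorem norm_firstCoords_lt {x : Fin s → ℂ} {r : ℝ} (hr : 0 < r) (hx : ‖x‖ < r) :
    ‖(firstCoords x : Fin n → ℂ)‖ < r := by
  rw [pi_norm_lt_iff hr]
  intro j
  by_cases h : (j : ℕ) < s
  · simp only [firstCoords, h, dite_true]
    exact (norm_le_pi_norm x _).trans_lt hx
  · simp only [firstCoords, h, dite_false, norm_zero]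
    exact hr

@[to_additive]
theorem prod_eq_prod_castLE {M : Type*} [CommMonoid M] (h : s ≤ n) {g : Fin n → M}
    (hg : ∀ j : Fin n, s ≤ (j : ℕ) → g j = 1) : ∏ j, g j = ∏ j : Fin s, g (Fin.castLE h j) := by
  refine (Finset.prod_of_injOn (Fin.castLE h) (Fin.castLE_injective h).injOn
    (fun _ _ => Finset.mem_coe.2 (Finset.mem_univ _)) (fun j _ hj => hg j ?_) fun _ _ => rfl).symm
  by_contra hlt
  exact hj ⟨⟨j, by omega⟩, by simp, by ext; simp⟩

theorem monomialPow_eq_castLE (h : s ≤ n) {α : Fin n → ℕ}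
    (hα : ∀ j : Fin n, s ≤ (j : ℕ) → α j = 0) (z : Fin n → ℂ) :
    monomialPow z α = monomialPow (fun j => z (Fin.castLE h j)) (fun j => α (Fin.castLE h j)) :=
  prod_eq_prod_castLE h fun j hj => by rw [hα j hj, pow_zero]

theorem gcd_eq_castLE (h : s ≤ n) {α : Fin n → ℕ} (hα : ∀ j : Fin n, s ≤ (j : ℕ) → α j = 0) :
    Finset.univ.gcd α = Finset.univ.gcd (fun j : Fin s => α (Fin.castLE h j)) := by
  apply Nat.dvd_antisymm
  · exact Finset.dvd_gcd fun j _ => Finset.gcd_dvd (Finset.mem_univ (Fin.castLE h j))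
  · refine Finset.dvd_gcd fun j _ => ?_
    by_cases hj : (j : ℕ) < s
    · exact Finset.gcd_dvd (f := fun j : Fin s => α (Fin.castLE h j)) (Finset.mem_univ ⟨j, hj⟩)
    · rw [hα j (by omega)]
      exact dvd_zero _

end FirstCoords

/-- The base of the parabolic manifold: one coordinate ranges over a half strip, the others over
the unit disc. -/
def petalBase {s : ℕ} (j₀ : Fin s) (R : ℝ) : Set (Fin s → ℂ) :=
  Set.pi univ fun j => if j = j₀ then halfStrip R else Metric.ball 0 1

section PetalBase

variable {s : ℕ} {j₀ : Fin s} {R : ℝ}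

theorem mem_petalBase {X : Fin s → ℂ} :
    X ∈ petalBase j₀ R ↔ X j₀ ∈ halfStrip R ∧ ∀ j, j ≠ j₀ → ‖X j‖ < 1 := by
  constructor
  · intro h
    refine ⟨by simpa using h j₀ (mem_univ _), fun j hj => ?_⟩
    simpa [hj] using h j (mem_univ _)
  · rintro ⟨h1, h2⟩ j -
    by_cases hj : j = j₀
    · subst hj
      simpa using h1
    · simpa [hj] using h2 j hj

theorem isOpen_petalBase : IsOpen (petalBase j₀ R) := by
  refine isOpen_set_pi finite_univ fun j _ => ?_
  split_ifs
  · exact isOpen_halfStrip R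
  · exact Metric.isOpen_ball

theorem convex_halfStrip (R : ℝ) : Convex ℝ (halfStrip R) := by
  have : halfStrip R = {ψ : ℂ | R < ψ.re} ∩ ({ψ : ℂ | -1 < ψ.im} ∩ {ψ : ℂ | ψ.im < 1}) := by
    ext ψ
    exact and_congr_right fun _ => abs_lt
  rw [this]
  exact (convex_halfSpace_re_gt R).inter
    ((convex_halfSpace_im_gt (-1)).inter (convex_halfSpace_im_lt 1))

theorem convex_petalBase : Convex ℝ (petalBase j₀ R) := by
  refine convex_pi fun j _ => ?_
  split_ifs
  · exact convex_halfStrip R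
  · exact convex_ball 0 1

theorem petalBase_nonempty : (petalBase j₀ R).Nonempty := by
  refine ⟨Pi.single j₀ ((R + 1 : ℝ) : ℂ), mem_petalBase.2 ⟨?_, fun j hj => ?_⟩⟩
  · rw [Pi.single_eq_same]
    refine ⟨?_, ?_⟩
    · rw [Complex.ofReal_re]
      linarith
    · rw [Complex.ofReal_im, abs_zero]
      exact one_pos
  · rw [Pi.single_eq_of_ne hj, norm_zero]
    exact one_pos

theorem add_single_mem_petalBase {X : Fin s → ℂ} (hX : X ∈ petalBase j₀ R) :
    X + Pi.single j₀ 1 ∈ petalBase j₀ R := by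
  rw [mem_petalBase] at hX ⊢
  refine ⟨?_, fun j hj => ?_⟩
  · rw [Pi.add_apply, Pi.single_eq_same]
    refine ⟨?_, ?_⟩
    · rw [Complex.add_re, Complex.one_re]
      linarith [hX.1.1]
    · rw [Complex.add_im, Complex.one_im, add_zero]
      exact hX.1.2
  · rw [Pi.add_apply, Pi.single_eq_of_ne hj, add_zero]
    exact hX.2 j hj

end PetalBase

/-- The coordinates `V` other than `j₀` are free, and the one at `j₀` is determined by
`∑ α_j V_j = c`. -/
noncomputable def fiberCoord {s : ℕ} (α : Fin s → ℕ) (j₀ : Fin s) (c : ℂ) (X : Fin s → ℂ)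
    (j : Fin s) : ℂ :=
  if j = j₀ then (c - ∑ i ∈ Finset.univ.erase j₀, α i * X i) / α j₀ else X j

section FiberCoord

variable {s : ℕ} {α : Fin s → ℕ} {j₀ : Fin s} {c : ℂ}

theorem sum_fiberCoord (hj₀ : α j₀ ≠ 0) (X : Fin s → ℂ) :
    ∑ j, α j * fiberCoord α j₀ c X j = c := by
  have h : (α j₀ : ℂ) ≠ 0 := by exact_mod_cast hj₀
  rw [← Finset.add_sum_erase _ _ (Finset.mem_univ j₀), fiberCoord, if_pos rfl,
    mul_div_cancel₀ _ h, sub_add_eq_add_sub, sub_eq_iff_eq_add, add_right_inj]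
  refine Finset.sum_congr rfl fun j hj => ?_
  rw [fiberCoord, if_neg (Finset.ne_of_mem_erase hj)]

theorem fiberCoord_add_single (X : Fin s → ℂ) (t : ℂ) :
    fiberCoord α j₀ c (X + Pi.single j₀ t) = fiberCoord α j₀ c X := by
  have h : ∀ j, j ≠ j₀ → (X + Pi.single j₀ t : Fin s → ℂ) j = X j := fun j hj => by
    rw [Pi.add_apply, Pi.single_eq_of_ne hj, add_zero]
  ext j
  unfold fiberCoord
  split_ifs with hj
  · congr 2
    exact Finset.sum_congr rfl fun i hi => by rw [h i (Finset.ne_of_mem_erase hi)]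
  · exact h j hj

theorem contDiff_fiberCoord (j : Fin s) : ContDiff ℂ 1 (fun X => fiberCoord α j₀ c X j) := by
  unfold fiberCoord
  split_ifs
  · fun_prop
  · fun_prop

theorem norm_fiberCoord_le (hj₀ : α j₀ ≠ 0) {R : ℝ} {X : Fin s → ℂ} (hX : X ∈ petalBase j₀ R)
    (j : Fin s) : ‖fiberCoord α j₀ c X j‖ ≤ 1 + ‖c‖ + ∑ i, (α i : ℝ) := by
  rw [mem_petalBase] at hX
  have h0 : 0 ≤ ∑ i, (α i : ℝ) := by positivity
  unfold fiberCoord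
  split_ifs with hj
  · rw [norm_div, Complex.norm_natCast]
    have h1 : (1 : ℝ) ≤ α j₀ := by exact_mod_cast Nat.pos_of_ne_zero hj₀
    refine (div_le_self (norm_nonneg _) h1).trans ((norm_sub_le _ _).trans ?_)
    have h2 : ‖∑ i ∈ Finset.univ.erase j₀, (α i : ℂ) * X i‖ ≤ ∑ i, (α i : ℝ) := by
      refine (norm_sum_le_of_le (f := fun i => (α i : ℂ) * X i) (n := fun i => (α i : ℝ)) _
        fun i hi => ?_).trans ?_
      · rw [norm_mul, Complex.norm_natCast]
        exact mul_le_of_le_one_right (by positivity) (hX.2 i (Finset.ne_of_mem_erase hi)).le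
      · exact Finset.sum_le_sum_of_subset_of_nonneg (Finset.subset_univ _)
          fun _ _ _ => by positivity
    linarith
  · have := hX.2 j hj
    have := norm_nonneg c
    linarith

end FiberCoord

/-- A family of `d` holomorphic immersions of the base, cyclically permuted by the normal form
dynamics, whose images together are embedded and attracted to the origin. -/
theorem exists_petal_family {s : ℕ} {lam : Fin s → ℂ} {α β : Fin s → ℕ} {d : ℕ} {A : Fin s → ℂ}
    {L : Fin s → ℂ → ℂ} {k : ℕ} {ρ C : ℝ} (hL : LogMultipliers A L k ρ C)
    (hmod : ∀ j, ‖lam j‖ = 1) (hlam : monomialPow lam α = 1) (hd : d = Finset.univ.gcd α)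
    (hβ : α = d • β) (hprim : ∀ i, 1 ≤ i → i < d → monomialPow lam β ^ i ≠ 1)
    {Λ : ℂ} (hΛ : Λ = ∑ j, α j * A j) (hΛ0 : Λ ≠ 0) (hA : ∀ j, 0 < (A j / Λ).re)
    {j₀ : Fin s} (hj₀ : α j₀ ≠ 0) {r : ℝ} (hr : 0 < r) :
    ∃ (R : ℝ) (Z : ℕ → (Fin s → ℂ) → Fin s → ℂ),
      (∀ i, ∀ X ∈ petalBase j₀ R, ContDiffAt ℂ 1 (Z i) X ∧
        Function.Injective (fderiv ℂ (Z i) X) ∧ Z i X ≠ 0 ∧ ‖Z i X‖ < r) ∧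
      (∀ i < d, ∀ i' < d, ∀ X ∈ petalBase j₀ R, ∀ X' ∈ petalBase j₀ R,
        Z i X = Z i' X' → i = i' ∧ X = X') ∧
      (∀ i, ∀ X ∈ petalBase j₀ R, ∀ j, Z (i + 1) (X + Pi.single j₀ 1) j
        = lam j * Z i X j * Complex.exp (L j (monomialPow (Z i X) α))) ∧
      Z d = Z 0 ∧
      ∀ i, ∀ X ∈ petalBase j₀ R,
        Tendsto (fun l : ℕ => Z (i + l) (X + Pi.single j₀ (l : ℂ))) atTop (𝓝 0) := by
  have hα : α ≠ 0 := fun h => hj₀ (by rw [h]; rfl)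
  have hd0 : d ≠ 0 := by
    rintro rfl
    exact hα (by rw [hβ, zero_smul])
  have hdC : (d : ℂ) ≠ 0 := by exact_mod_cast hd0
  have hk := hL.one_le
  have hkC : (k : ℂ) ≠ 0 := by
    have : k ≠ 0 := by omega
    exact_mod_cast this
  obtain ⟨τ, hτ⟩ : ∃ τ : ℂ, k * Λ * τ ^ k = -1 := by
    obtain ⟨τ, hτ⟩ := IsAlgClosed.exists_pow_nat_eq (-1 / (k * Λ)) (show 0 < k by omega)
    refine ⟨τ, ?_⟩
    rw [hτ]
    field_simp
  have hτ0 : τ ≠ 0 := by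
    rintro rfl
    rw [zero_pow (by omega), mul_zero] at hτ
    norm_num at hτ
  obtain ⟨θ, ζ, hθ, hlamζ, hζ⟩ := exists_roots_of_unity hα hmod hlam
  rw [← hd] at hζ
  have hζ1 : ∀ j, ‖ζ j‖ = 1 := fun j => Complex.norm_eq_one_of_pow_eq_one (hζ j) hd0
  have hζ0 : ∀ j, ζ j ≠ 0 := fun j => norm_pos_iff.1 (by rw [hζ1]; exact one_pos)
  have hαβ : ∀ j, α j = d * β j := fun j => by
    conv_lhs => rw [hβ]
    rfl
  have hω : monomialPow lam β = monomialPow ζ β := by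
    have h1 : lam = fun j => ζ j * Complex.exp (Complex.I * θ j) := funext hlamζ
    have h2 : ∑ j, (β j : ℂ) * (Complex.I * θ j) = 0 := by
      have h3 : ∑ j, (α j : ℂ) * θ j = 0 := by exact_mod_cast hθ
      apply mul_left_cancel₀ hdC
      rw [mul_zero, ← mul_zero Complex.I, ← h3, Finset.mul_sum, Finset.mul_sum]
      refine Finset.sum_congr rfl fun j _ => ?_
      rw [hαβ]
      push_cast
      ring
    rw [h1, monomialPow_mul, monomialPow_exp, h2, Complex.exp_zero, mul_one]
  set κ : ℝ := 1 + ‖Complex.log τ‖ + ∑ i, (α i : ℝ) with hκ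
  obtain ⟨R, w, Y, hw, hYi, hY', hwY, hwstep, hwB, hwlim⟩ :=
    exists_petal_coordinates hL α hΛ hΛ0 hA hτ θ hθ (Real.log (r / 2) - κ)
  set V := fiberCoord α j₀ (Complex.log τ) with hV
  set e : Fin s → (Fin s → ℂ) → ℂ := fun j X => V X j + w j (X j₀) with he
  set Z : ℕ → (Fin s → ℂ) → Fin s → ℂ := fun i X j => ζ j ^ i * Complex.exp (e j X) with hZ
  have hVsum : ∀ X, ∑ j, α j * V X j = Complex.log τ := sum_fiberCoord hj₀
  have hesum : ∀ X ∈ petalBase j₀ R, ∑ j, α j * e j X = Complex.log τ + Y (X j₀) := by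
    intro X hX
    simp only [he, mul_add, Finset.sum_add_distrib]
    rw [hVsum, hwY _ (mem_petalBase.1 hX).1]
  have hmono : ∀ i, ∀ X ∈ petalBase j₀ R,
      monomialPow (Z i X) α = τ * Complex.exp (Y (X j₀)) := by
    intro i X hX
    have h1 : monomialPow ζ α = 1 := by
      refine Finset.prod_eq_one fun j _ => ?_
      rw [hαβ, pow_mul, hζ, one_pow]
    simp only [hZ]
    rw [monomialPow_mul, monomialPow_pow, monomialPow_exp, h1, one_pow, one_mul, hesum X hX,
      Complex.exp_add, Complex.exp_log hτ0]
  have hwC : ∀ X ∈ petalBase j₀ R, ∀ j, ContDiffAt ℂ 1 (fun X : Fin s → ℂ => w j (X j₀)) X := by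
    intro X hX j
    have h1 : ContDiffAt ℂ 1 (w j) (X j₀) :=
      ((hw j).contDiffOn (isOpen_halfStrip R)).contDiffAt
        ((isOpen_halfStrip R).mem_nhds (mem_petalBase.1 hX).1)
    exact h1.comp X (contDiff_apply ℂ ℂ j₀).contDiffAt
  have heC : ∀ X ∈ petalBase j₀ R, ∀ j, ContDiffAt ℂ 1 (e j) X := fun X hX j =>
    (contDiff_fiberCoord j).contDiffAt.add (hwC X hX j)
  have hZC : ∀ i, ∀ X ∈ petalBase j₀ R, ContDiffAt ℂ 1 (Z i) X := fun i X hX =>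
    contDiffAt_pi.2 fun j => contDiffAt_const.mul (heC X hX j).cexp
  refine ⟨R, Z, fun i X hX => ⟨hZC i X hX, ?_, ?_, ?_⟩, ?_, ?_, ?_, ?_⟩
  · rw [injective_iff_map_eq_zero]
    intro v hv
    have hev : ∀ j, fderiv ℂ (e j) X v = 0 := by
      intro j
      have h1 := hasFDerivAt_pi'.1 (((hZC i X hX).differentiableAt one_ne_zero).hasFDerivAt) j
      have h2 := (((heC X hX j).differentiableAt one_ne_zero).hasFDerivAt.cexp).const_mul (ζ j ^ i)
      have h3 := congrArg (fun T : (Fin s → ℂ) →L[ℂ] ℂ => T v) (h1.unique h2)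
      simp only [ContinuousLinearMap.comp_apply, hv, map_zero, smul_apply,
        smul_eq_mul] at h3
      have h4 := mul_ne_zero (pow_ne_zero i (hζ0 j)) (Complex.exp_ne_zero (e j X))
      rw [← mul_assoc] at h3
      exact (mul_eq_zero.1 h3.symm).resolve_left h4
    have hXs := (mem_petalBase.1 hX).1
    have hv0 : v j₀ = 0 := by
      have h1 : HasFDerivAt (fun X => ∑ j, (α j : ℂ) * e j X)
          (∑ j, (α j : ℂ) • fderiv ℂ (e j) X) X :=
        HasFDerivAt.fun_sum fun j _ =>
          ((heC X hX j).differentiableAt one_ne_zero).hasFDerivAt.const_mul _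
      have h2 : HasFDerivAt (fun X : Fin s → ℂ => Complex.log τ + Y (X j₀))
          (deriv Y (X j₀) • (ContinuousLinearMap.proj j₀ : (Fin s → ℂ) →L[ℂ] ℂ)) X :=
        (((differentiableAt_of_deriv_ne_zero (hY' _ hXs)).hasDerivAt).comp_hasFDerivAt X
          (hasFDerivAt_apply j₀ X)).const_add _
      have h3 : (fun X => ∑ j, (α j : ℂ) * e j X) =ᶠ[𝓝 X] fun X => Complex.log τ + Y (X j₀) := by
        filter_upwards [isOpen_petalBase.mem_nhds hX] with X' hX'
        exact hesum X' hX'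
      have h4 := congrArg (fun T : (Fin s → ℂ) →L[ℂ] ℂ => T v)
        ((h2.congr_of_eventuallyEq h3).unique h1)
      simp [hev] at h4
      exact h4.resolve_left (hY' _ hXs)
    ext j
    by_cases hj : j = j₀
    · rw [hj]
      exact hv0
    · have h1 : HasFDerivAt (e j) ((ContinuousLinearMap.proj j : (Fin s → ℂ) →L[ℂ] ℂ)
          + deriv (w j) (X j₀) • (ContinuousLinearMap.proj j₀ : (Fin s → ℂ) →L[ℂ] ℂ)) X := by
        have h2 : e j = fun X => X j + w j (X j₀) := by
          simp only [he, hV, fiberCoord, if_neg hj]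
        rw [h2]
        refine (hasFDerivAt_apply j X).add ?_
        exact (((hw j).differentiableAt ((isOpen_halfStrip R).mem_nhds hXs)).hasDerivAt).comp_hasFDerivAt
          X (hasFDerivAt_apply j₀ X)
      have h3 := hev j
      rw [h1.fderiv] at h3
      simpa [hv0] using h3
  · intro h0
    exact mul_ne_zero (pow_ne_zero i (hζ0 j₀)) (Complex.exp_ne_zero (e j₀ X)) (congrFun h0 j₀)
  · rw [pi_norm_lt_iff hr]
    intro j
    simp only [hZ]
    rw [norm_mul, norm_pow, hζ1, one_pow, one_mul, Complex.norm_exp]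
    have h1 := (Complex.re_le_norm _).trans (norm_fiberCoord_le (c := Complex.log τ) hj₀ hX j)
    have h2 := hwB _ (mem_petalBase.1 hX).1 j
    have h3 : (e j X).re ≤ Real.log (r / 2) := by
      simp only [he, Complex.add_re]
      linarith
    calc Real.exp (e j X).re ≤ Real.exp (Real.log (r / 2)) := Real.exp_le_exp.2 h3
      _ = r / 2 := Real.exp_log (by positivity)
      _ < r := by linarith
  · intro i hi i' hi' X hX X' hX' h
    have hXs := (mem_petalBase.1 hX)
    have hXs' := (mem_petalBase.1 hX')
    have h1 : X j₀ = X' j₀ := by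
      refine hYi hXs.1 hXs'.1 (mul_left_cancel₀ hτ0 ?_)
      have := congrArg (fun z => monomialPow z α) h
      simpa only [hmono i X hX, hmono i' X' hX'] using this
    have h2 : ∀ j, ζ j ^ i * Complex.exp (V X j) = ζ j ^ i' * Complex.exp (V X' j) := by
      intro j
      have := congrFun h j
      simp only [hZ, he, h1, Complex.exp_add, ← mul_assoc] at this
      exact mul_right_cancel₀ (Complex.exp_ne_zero _) this
    have hVβ : ∀ X, ∑ j, β j * V X j = Complex.log τ / d := by
      intro X
      rw [eq_div_iff hdC, ← hVsum X, Finset.sum_mul]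
      refine Finset.sum_congr rfl fun j _ => ?_
      rw [hαβ]
      push_cast
      ring
    have h3 : monomialPow ζ β ^ i = monomialPow ζ β ^ i' := by
      have h4 := congrArg (fun z => monomialPow z β) (funext h2)
      simp only [monomialPow_mul, monomialPow_pow, monomialPow_exp, hVβ] at h4
      exact mul_right_cancel₀ (Complex.exp_ne_zero _) h4
    have hω0 : monomialPow ζ β ≠ 0 := Finset.prod_ne_zero_iff.2 fun j _ => pow_ne_zero _ (hζ0 j)
    rw [hω] at hprim
    have hlt : ∀ a b : ℕ, a < b → b < d → monomialPow ζ β ^ a ≠ monomialPow ζ β ^ b := by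
      intro a b hab hbd hpow
      refine hprim (b - a) (by omega) (by omega) (mul_left_cancel₀ (pow_ne_zero a hω0) ?_)
      rw [← pow_add, Nat.add_sub_of_le hab.le, mul_one, hpow]
    have h5 : i = i' := by
      rcases lt_trichotomy i i' with hlt' | heq | hlt'
      · exact absurd h3 (hlt i i' hlt' hi')
      · exact heq
      · exact absurd h3.symm (hlt i' i hlt' hi)
    refine ⟨h5, funext fun j => ?_⟩
    by_cases hj : j = j₀
    · rw [hj, h1]
    · have h6 := h2 j
      rw [h5] at h6
      have h7 := mul_left_cancel₀ (pow_ne_zero _ (hζ0 j)) h6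
      simp only [hV, fiberCoord, if_neg hj] at h7
      have hpi := Real.pi_gt_three
      have b1 := abs_lt.1 ((Complex.abs_im_le_norm _).trans_lt (hXs.2 j hj))
      have b2 := abs_lt.1 ((Complex.abs_im_le_norm _).trans_lt (hXs'.2 j hj))
      rw [← Complex.log_exp (x := X j) (by linarith) (by linarith), h7,
        Complex.log_exp (by linarith) (by linarith)]
  · intro i X hX j
    rw [hmono i X hX]
    have h1 := hwstep _ (mem_petalBase.1 hX).1 j
    simp only [hZ, he, hV, fiberCoord_add_single, Pi.add_apply, Pi.single_eq_same]
    rw [h1, hlamζ, pow_succ, Complex.exp_add, Complex.exp_add, Complex.exp_add, Complex.exp_add]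
    ring
  · funext X j
    simp only [hZ, hζ, pow_zero]
  · intro i X hX
    refine tendsto_pi_nhds.2 fun j => ?_
    rw [Pi.zero_apply, tendsto_zero_iff_norm_tendsto_zero]
    have h1 : ∀ l : ℕ, ‖Z (i + l) (X + Pi.single j₀ (l : ℂ)) j‖
        = Real.exp ((V X j).re + (w j (X j₀ + l)).re) := by
      intro l
      simp only [hZ, he, hV, fiberCoord_add_single, Pi.add_apply, Pi.single_eq_same]
      rw [norm_mul, norm_pow, hζ1, one_pow, one_mul, Complex.norm_exp, Complex.add_re]
    simp only [h1]
    exact Real.tendsto_exp_atBot.comp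
      (tendsto_const_nhds.add_atBot (hwlim _ (mem_petalBase.1 hX).1 j))

/-- An injective `C¹` map between spaces of the same finite dimension, with injective derivative,
is an open embedding. -/
theorem isOpenEmbedding_of_contDiffAt {E : Type*} [NormedAddCommGroup E] [NormedSpace ℂ E]
    [FiniteDimensional ℂ E] {f : E → E} {U : Set E} (hU : IsOpen U)
    (hf : ∀ x ∈ U, ContDiffAt ℂ 1 f x) (hf' : ∀ x ∈ U, Function.Injective (fderiv ℂ f x))
    (hinj : InjOn f U) : IsOpenEmbedding (U.domRestrict f) := by
  have : CompleteSpace E := FiniteDimensional.complete ℂ E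
  refine IsOpenEmbedding.of_continuous_injective_isOpenMap ?_ ?_ ?_
  · exact continuousOn_iff_continuous_domRestrict.1 fun x hx =>
      (hf x hx).continuousAt.continuousWithinAt
  · exact injOn_iff_injective.1 hinj
  · refine isOpenMap_iff_nhds_le.2 fun x => ?_
    have hs := (hf x x.2).hasStrictFDerivAt one_ne_zero
    have hsurj : (fderiv ℂ f x).range = ⊤ := by
      have := LinearMap.injective_iff_surjective.1 (hf' x x.2)
      exact LinearMap.range_eq_top.2 this
    have h1 := hs.map_nhds_eq_of_surj hsurj
    have h2 : map (U.domRestrict f) (𝓝 x) = 𝓝 (f x) := by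
      rw [← h1, ← map_nhds_subtype_coe_eq_nhds x.2 (hU.mem_nhds x.2), Filter.map_map]
      rfl
    exact h2.ge

/-- Composing with a map that has a differentiable left inverse preserves being a biholomorphic
image. -/
theorem isBiholomorphicImage_of_leftInverse {s n : ℕ} {D : Set (Fin s → ℂ)} (hD : IsOpen D)
    {φ : (Fin s → ℂ) → Fin n → ℂ} {Ψ : (Fin n → ℂ) → Fin s → ℂ} {W : Set (Fin n → ℂ)}
    (hW : IsOpen W) (hφ : DifferentiableOn ℂ φ D) (hφW : MapsTo φ D W)
    (hΨ : DifferentiableOn ℂ Ψ W) (hC : ∀ x ∈ D, ContDiffAt ℂ 1 (fun x => Ψ (φ x)) x)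
    (hinj' : ∀ x ∈ D, Function.Injective (fderiv ℂ (fun x => Ψ (φ x)) x))
    (hinj : InjOn (fun x => Ψ (φ x)) D) : IsBiholomorphicImage D (φ '' D) := by
  refine ⟨φ, hφ, fun x hx => ?_, ?_, rfl⟩
  · have h1 := ((hΨ.differentiableAt (hW.mem_nhds (hφW hx))).hasFDerivAt).comp x
      (hφ.differentiableAt (hD.mem_nhds hx)).hasFDerivAt
    have h2 := hinj' x hx
    have h3 : fderiv ℂ (fun x => Ψ (φ x)) x = (fderiv ℂ Ψ (φ x)).comp (fderiv ℂ φ x) := h1.fderiv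
    rw [h3, ContinuousLinearMap.coe_comp] at h2
    exact h2.of_comp
  · have hemb := (isOpenEmbedding_of_contDiffAt hD hC hinj' hinj).isEmbedding
    have hφc : Continuous (hφW.restrict φ D W) := hφ.continuousOn.mapsToRestrict hφW
    have hΨc : Continuous (W.domRestrict Ψ) :=
      continuousOn_iff_continuous_domRestrict.1 hΨ.continuousOn
    have h1 : IsEmbedding (hφW.restrict φ D W) := IsEmbedding.of_comp hφc hΨc hemb
    exact IsEmbedding.subtypeVal.comp h1

theorem exists_parabolicManifold {s n d : ℕ}
    {G Φ : OpenPartialHomeomorph (Fin n → ℂ) (Fin n → ℂ)} (hΦ : IsBiholomorphicGerm Φ)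
    {lam : Fin n → ℂ} {α : Fin n → ℕ} {A : Fin n → ℂ}
    {L : Fin n → ℂ → ℂ} {k : ℕ} {ρ C r : ℝ} (hL : LogMultipliers A L k ρ C)
    (hchart : IsNormalChart G Φ lam α L r)
    (hmod : ∀ j, ‖lam j‖ = 1) (hlam : monomialPow lam α = 1) (hα0 : α ≠ 0)
    (hd : d = Finset.univ.gcd α)
    (hprim : ∀ β : Fin n → ℕ, α = d • β → ∀ i, 1 ≤ i → i < d → monomialPow lam β ^ i ≠ 1)
    {Λ : ℂ} (hΛ : Λ = ∑ j, α j * A j) (hΛ0 : Λ ≠ 0) (hs : s ≤ n)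
    (hA : ∀ j : Fin n, (j : ℕ) < s → 0 < (A j / Λ).re)
    (hα : ∀ j : Fin n, s ≤ (j : ℕ) → α j = 0) :
    ∃ P : Set (Fin n → ℂ), IsParabolicManifold G s d P := by
  obtain ⟨j₁, hj₁⟩ := Function.ne_iff.1 hα0
  have hj₁s : (j₁ : ℕ) < s := by
    by_contra h
    exact hj₁ (hα j₁ (by omega))
  have hd0 : 0 < d := by
    rw [hd]
    exact Nat.pos_of_ne_zero fun h => hj₁ (Finset.gcd_eq_zero_iff.1 h j₁ (Finset.mem_univ _))
  obtain ⟨β, hβ⟩ : ∃ β : Fin n → ℕ, α = d • β := by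
    choose β hβ using fun j => hd ▸ Finset.gcd_dvd (f := α) (Finset.mem_univ j)
    exact ⟨β, funext hβ⟩
  have hβ0 : ∀ j : Fin n, s ≤ (j : ℕ) → β j = 0 := by
    intro j hj
    have h1 := hα j hj
    rw [hβ, Pi.smul_apply, smul_eq_mul] at h1
    exact (mul_eq_zero.1 h1).resolve_left hd0.ne'
  set c := Fin.castLE hs with hc
  set j₀ : Fin s := ⟨j₁, hj₁s⟩
  obtain ⟨R, Z, hZ, hZinj, hZstep, hZd, hZlim⟩ := exists_petal_family (lam := fun j => lam (c j))
    (α := fun j => α (c j)) (β := fun j => β (c j)) (d := d) (hL.comp c) (fun j => hmod (c j))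
    (by rw [← hlam, monomialPow_eq_castLE hs hα lam]) (by rw [hd, gcd_eq_castLE hs hα])
    (funext fun j => congrFun hβ (c j)) (fun i hi hid => by
      rw [← monomialPow_eq_castLE hs hβ0 lam]
      exact hprim β hβ i hi hid) (Λ := Λ)
    (by
      rw [hΛ]
      exact sum_eq_sum_castLE hs fun j hj => by rw [hα j hj, Nat.cast_zero, zero_mul]) hΛ0
    (fun j => hA (c j) j.2) (j₀ := j₀) hj₁ hchart.r_pos
  set D₀ := petalBase j₀ R with hD₀
  set t : ℕ → Fin s → ℂ := fun i => Pi.single j₀ (-(4 * i * Complex.I)) with ht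
  set D : Fin d → Set (Fin s → ℂ) := fun i => (fun X => t i + X) ⁻¹' D₀ with hD
  have hDopen : ∀ i, IsOpen (D i) := fun i => isOpen_petalBase.preimage (by fun_prop)
  have hDdisj : Pairwise (fun i j => Disjoint (D i) (D j)) := by
    intro i j hij
    refine Set.disjoint_left.2 fun X hXi hXj => hij ?_
    have h1 := (mem_petalBase.1 hXi).1.2
    have h2 := (mem_petalBase.1 hXj).1.2
    simp [ht] at h1 h2
    rw [abs_lt] at h1 h2
    have h3 : (i : ℝ) < j + 1 := by linarith
    have h4 : (j : ℝ) < i + 1 := by linarith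
    have h3' : (i : ℕ) < j + 1 := by exact_mod_cast h3
    have h4' : (j : ℕ) < i + 1 := by exact_mod_cast h4
    exact Fin.ext (by omega)
  have hDsc : ∀ i, IsSimplyConnected (D i) := by
    intro i
    have hne : (D i).Nonempty := by
      obtain ⟨X, hX⟩ := petalBase_nonempty (j₀ := j₀) (R := R)
      exact ⟨-t i + X, by simpa [hD] using hX⟩
    have := (convex_petalBase.translate_preimage_right (t i)).contractibleSpace hne
    exact SimplyConnectedSpace.ofContractible _
  classical
  set Zt : (Fin s → ℂ) → Fin s → ℂ := fun X =>
    if h : ∃ i, X ∈ D i then Z h.choose (t h.choose + X) else 0 with hZt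
  have hZtD : ∀ i : Fin d, ∀ X ∈ D i, Zt X = Z i (t i + X) := by
    intro i X hX
    have h : ∃ i, X ∈ D i := ⟨i, hX⟩
    have h1 : h.choose = i := by
      by_contra hne
      exact Set.disjoint_left.1 (hDdisj hne) h.choose_spec hX
    simp only [hZt, dif_pos h, h1]
  have hZtev : ∀ i : Fin d, ∀ X ∈ D i, Zt =ᶠ[𝓝 X] fun X => Z i (t i + X) := fun i X hX => by
    filter_upwards [(hDopen i).mem_nhds hX] with X' hX'
    exact hZtD i X' hX'
  have hopen : IsOpen (⋃ i, D i) := isOpen_iUnion hDopen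
  have hZtC : ∀ X ∈ ⋃ i, D i, ContDiffAt ℂ 1 Zt X := by
    intro X hX
    obtain ⟨i, hi⟩ := mem_iUnion.1 hX
    refine ContDiffAt.congr_of_eventuallyEq ?_ (hZtev i X hi)
    exact (hZ i _ hi).1.comp X (contDiffAt_const.add contDiffAt_id)
  have hZtr : ∀ X ∈ ⋃ i, D i, ‖Zt X‖ < r := by
    intro X hX
    obtain ⟨i, hi⟩ := mem_iUnion.1 hX
    rw [hZtD i X hi]
    exact (hZ i _ hi).2.2.2
  have hball : ∀ x : Fin s → ℂ, ‖x‖ < r → (firstCoords x : Fin n → ℂ) ∈ Metric.ball 0 r :=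
    fun x hx => mem_ball_zero_iff.2 (norm_firstCoords_lt hchart.r_pos hx)
  set φ : (Fin s → ℂ) → Fin n → ℂ := fun X => Φ.symm (firstCoords (Zt X)) with hφ
  have hΦφ : ∀ X ∈ ⋃ i, D i, (fun j => Φ (φ X) (c j)) = Zt X := by
    intro X hX
    simp only [hφ]
    rw [Φ.right_inv (hchart.mem_target _ (hball _ (hZtr X hX)))]
    exact funext fun j => firstCoords_castLE hs _ j
  have hstep : ∀ i : ℕ, ∀ X ∈ D₀, G (Φ.symm (firstCoords (Z i X)))
      = Φ.symm (firstCoords (Z (i + 1) (X + Pi.single j₀ 1))) := by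
    intro i X hX
    have hb := hball _ (hZ i X hX).2.2.2
    rw [← Φ.left_inv (hchart.map_mem_source _ hb)]
    congr 1
    ext j
    rw [hchart.conj _ hb j, monomialPow_eq_castLE hs hα]
    by_cases hj : (j : ℕ) < s
    · have := hZstep i X hX ⟨j, hj⟩
      have e : ∀ x : Fin s → ℂ, (firstCoords x : Fin n → ℂ) j = x ⟨j, hj⟩ := fun x =>
        firstCoords_castLE hs x ⟨j, hj⟩
      simp only [firstCoords_castLE, e, this]
      rfl
    · simp [firstCoords, hj]
  have hiter : ∀ (l i : ℕ), ∀ X ∈ D₀, X + Pi.single j₀ (l : ℂ) ∈ D₀ ∧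
      G^[l] (Φ.symm (firstCoords (Z i X)))
        = Φ.symm (firstCoords (Z (i + l) (X + Pi.single j₀ (l : ℂ)))) := by
    intro l i X hX
    induction l with
    | zero => simpa using hX
    | succ l ih =>
      have e : X + Pi.single j₀ ((l + 1 : ℕ) : ℂ)
          = X + Pi.single j₀ (l : ℂ) + Pi.single j₀ 1 := by
        rw [add_assoc, ← Pi.single_add]
        push_cast
        rfl
      rw [e, Function.iterate_succ_apply', ih.2, hstep _ _ ih.1]
      exact ⟨add_single_mem_petalBase ih.1, rfl⟩
  have hmem : ∀ p, p ∈ φ '' (⋃ i, D i) ↔ ∃ i < d, ∃ X ∈ D₀, Φ.symm (firstCoords (Z i X)) = p := by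
    intro p
    constructor
    · rintro ⟨X, hX, rfl⟩
      obtain ⟨i, hi⟩ := mem_iUnion.1 hX
      exact ⟨i, i.2, t i + X, hi, by simp only [hφ, hZtD i X hi]⟩
    · rintro ⟨i, hid, X, hX, rfl⟩
      have hi : -t i + X ∈ D ⟨i, hid⟩ := by simpa [hD] using hX
      refine ⟨-t i + X, mem_iUnion.2 ⟨_, hi⟩, ?_⟩
      simp only [hφ, hZtD _ _ hi, add_neg_cancel_left]
  obtain ⟨h0t, h0s⟩ := hΦ.symm_zero
  have hlim : ∀ i : ℕ, ∀ X ∈ D₀,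
      Tendsto (fun l : ℕ => G^[l] (Φ.symm (firstCoords (Z i X)))) atTop (𝓝 0) := by
    intro i X hX
    have h1 : ContinuousAt (fun x : Fin s → ℂ => Φ.symm (firstCoords x)) 0 := by
      refine ContinuousAt.comp ?_ contDiff_firstCoords.continuous.continuousAt
      rw [firstCoords_zero]
      exact Φ.continuousAt_symm h0t
    have h2 := h1.tendsto.comp (hZlim i X hX)
    rw [firstCoords_zero, h0s] at h2
    exact h2.congr fun l => (hiter l i X hX).2.symm
  have hmaps : MapsTo G (φ '' (⋃ i, D i)) (φ '' (⋃ i, D i)) := by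
    intro p hp
    obtain ⟨i, hid, X, hX, rfl⟩ := (hmem p).1 hp
    rw [hstep i X hX, hmem]
    by_cases h : i + 1 < d
    · exact ⟨i + 1, h, _, add_single_mem_petalBase hX, rfl⟩
    · refine ⟨0, hd0, _, add_single_mem_petalBase hX, ?_⟩
      rw [show i + 1 = d by omega, hZd]
  refine ⟨φ '' (⋃ i, D i), ⟨D, hDopen, hDsc, hDdisj, ?_⟩, ?_, ?_, ?_, hmaps, ?_⟩
  · refine isBiholomorphicImage_of_leftInverse hopen (Ψ := fun z j => Φ z (c j)) Φ.open_source
      ?_ ?_ ?_ ?_ ?_ ?_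
    · refine hΦ.differentiableOn_symm.comp ?_ fun X hX =>
        hchart.mem_target _ (hball _ (hZtr X hX))
      exact fun X hX => ((contDiff_firstCoords.contDiffAt.comp X (hZtC X hX)).differentiableAt
        one_ne_zero).differentiableWithinAt
    · exact fun X hX => Φ.map_target (hchart.mem_target _ (hball _ (hZtr X hX)))
    · exact differentiableOn_pi.2 fun j => (differentiableOn_pi.1 hΦ.differentiableOn) (c j)
    · intro X hX
      refine (hZtC X hX).congr_of_eventuallyEq ?_
      filter_upwards [hopen.mem_nhds hX] with X' hX'
      exact hΦφ X' hX'
    · intro X hX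
      obtain ⟨i, hi⟩ := mem_iUnion.1 hX
      have h1 : (fun X => fun j => Φ (φ X) (c j)) =ᶠ[𝓝 X] fun X => Z i (t i + X) := by
        filter_upwards [(hDopen i).mem_nhds hi] with X' hX'
        rw [hΦφ X' (mem_iUnion.2 ⟨i, hX'⟩), hZtD i X' hX']
      rw [h1.fderiv_eq, fderiv_comp_add_left]
      exact (hZ i _ hi).2.1
    · intro X hX X' hX' h
      obtain ⟨i, hi⟩ := mem_iUnion.1 hX
      obtain ⟨i', hi'⟩ := mem_iUnion.1 hX'
      have h1 : Zt X = Zt X' := by rw [← hΦφ X hX, ← hΦφ X' hX']; exact h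
      rw [hZtD i X hi, hZtD i' X' hi'] at h1
      obtain ⟨h2, h3⟩ := hZinj i i.2 i' i'.2 _ hi _ hi' h1
      rw [h2] at h3
      exact add_left_cancel h3
  · obtain ⟨X, hX⟩ := petalBase_nonempty (j₀ := j₀) (R := R)
    have hp : Φ.symm (firstCoords (Z 0 X)) ∈ φ '' (⋃ i, D i) := (hmem _).2 ⟨0, hd0, X, hX, rfl⟩
    exact mem_closure_of_tendsto (hlim 0 X hX) (Eventually.of_forall fun l => hmaps.iterate l hp)
  · intro h0
    obtain ⟨i, hid, X, hX, h⟩ := (hmem 0).1 h0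
    have h1 := Φ.symm.injOn (hchart.mem_target _ (hball _ (hZ i X hX).2.2.2)) h0t (h.trans h0s.symm)
    apply (hZ i X hX).2.2.1
    ext j
    have := congrFun h1 (c j)
    rwa [firstCoords_castLE] at this
  · intro p hp
    obtain ⟨i, hid, X, hX, rfl⟩ := (hmem p).1 hp
    exact hchart.mem_source _ (hball _ (hZ i X hX).2.2.2)
  · intro p hp
    obtain ⟨i, hid, X, hX, rfl⟩ := (hmem p).1 hp
    exact hlim i X hX

theorem mainTheorem3 {n : ℕ} (G : OpenPartialHomeomorph (Fin n → ℂ) (Fin n → ℂ))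
    (hG : IsBiholomorphicGerm G)
    (lam : Fin n → ℂ) (α : Fin n → ℕ) (hres : IsOneResonant G lam α)
    (hmod : ∀ j, ‖lam j‖ = 1) (hroot : ∀ j, ∀ q : ℕ, 1 ≤ q → lam j ^ q ≠ 1)
    (a : Fin n → ℕ → ℂ) (hnf : HasHolomorphicNormalForm G lam α a)
    (k₀ : ℕ) (hk₀ : IsWeightedOrder a k₀)
    (hnondeg : resonantLambda lam α a k₀ ≠ 0)
    (s : ℕ) (hs1 : 1 ≤ s) (hsn : s < n)
    (hpos : ∀ j : Fin n, (j : ℕ) < s →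
      0 < (a j k₀ / lam j * (1 / resonantLambda lam α a k₀)).re)
    (hneg : ∀ j : Fin n, s ≤ (j : ℕ) →
      (a j k₀ / lam j * (1 / resonantLambda lam α a k₀)).re < 0) :
    (¬ (∀ j : Fin n, s ≤ (j : ℕ) → α j = 0) →
      ∀ w : Fin n → ℂ, OrbitConvergesToOrigin G w ↔ w = 0) ∧
    ((∀ j : Fin n, s ≤ (j : ℕ) → α j = 0) →
      ∃ P : Set (Fin n → ℂ), IsParabolicManifold G s (Finset.univ.gcd α) P) := by
  have hlam0 : ∀ j, lam j ≠ 0 := fun j => norm_pos_iff.1 (by rw [hmod]; exact one_pos)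
  have hlam := hres.monomialPow_generator hlam0
  obtain ⟨Φ, hΦ, hF⟩ := hnf
  obtain ⟨L, ρ, C, hL, hLF⟩ := exists_logMultipliers hlam0 hres.generator_ne_zero hk₀
    (F := fun z => Φ (G (Φ.symm z))) hF
  obtain ⟨r, hchart⟩ := exists_isNormalChart hG hΦ hLF
  simp only [mul_one_div] at hpos hneg
  constructor
  · intro h w
    push Not at h
    obtain ⟨j, hj, hj0⟩ := h
    exact orbitConvergesToOrigin_iff hG hΦ hL hchart hmod hlam rfl hnondeg hj0 (hneg j hj) w
  · intro h
    exact exists_parabolicManifold hΦ hL hchart hmod hlam hres.generator_ne_zero rfl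
      (fun β hβ i hi hid => hres.monomialPow_ne_one hβ hi hid) rfl hnondeg hsn.le hpos h
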